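/- Let $G$ be a topological group. A \emph{model for $G$-equivariant twists} is a presheaf of monoidal groupoids $X\mapsto \mathrm{Twist}_G(X)$ on the category of $G$-spaces (pullbacks $f^*$ being functorial up to coherent monoidal isomorphism) such that, for all spaces in a class of $G$-spaces that is closed under invariant open subspaces and products with $[0,1]$ (for example all $G$-spaces), (1) there is a natural map $P\mapsto[P]\in H^3_G(X;\mathbb Z)=H^3(X\times_G EG;\mathbb Z)$ with $[P\otimes Q]=[P]+[Q]$, which induces a bijection from isomorphism classes of twists on $X$ onto $H^3_G(X;\mathbb Z)$; (2) the group of automorphisms of the trivial twist on $X$ is naturally isomorphic to $H^2_G(X;\mathbb Z)$; (3) if $X=U\cup V$ with $U,V$ open and $G$-invariant, $P_U$ and $P_V$ are twists on $U$ and $V$, and $u\colon P_U|_{U\cap V}\cong P_V|_{U\cap V}$, then there is a twist $P$ on $X$ with isomorphisms $\psi_U\colon P|_U\cong P_U$, $\psi_V\colon P|_V\cong P_V$ such that $u=\psi_V\circ\psi_U^{-1}$ over $U\cap V$, and $(P,\psi_U,\psi_V)$ is unique up to isomorphism. (Here cohomology is singular cohomology and $EG$ is Milnor's infinite join.) Fix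 such a model. Let $X$ be a $G$-space, let $\pi\colon E\to X$ and $\hat\pi\colon\hat E\to X$ be $G$-equivariant principal $S^1$-bundles, and let $p,\hat p$ be the projections of $E\times_X\hat E$ to $E$ and $\hat E$. Let $S(E,\hat E)$ be the unit sphere bundle of $L\oplus\hat L$, where $L=E\times_{S^1}\mathbb C$ and $\hat L=\hat E\times_{S^1}\mathbb C$, and let $i\colon E\to S(E,\hat E)$, $e\mapsto([e,1],0)$, and $\hat\imath\colon\hat E\to S(E,\hat E)$, $\hat e\mapsto(0,[\hat e,1])$, be the inclusions. Assume that $E$, $\hat E$, $E\times_X\hat E$ and $S(E,\hat E)$ belong to the class of spaces above. Let $P$ and $\hat P$ be $G$-equivariant twists on $E$ and $\hat E$. Then there is a bijection between the set of isomorphisms $u\colon p^*P\to\hat p^*\hat P$ and the set of isomorphism classes of twists on $S(E,\hat E)$ that restrict to $P$ and $\hat P$, i.e. of triples $(T,\varphi,\hat\varphi)$ consisting of a twist $T$ on $S(E,\hat E)$ and isomorphisms $\varphi\colon T|_E=i^*T\cong P$ and $\hat\varphi\colon T|_{\hat E}=\hat\imath^*T\cong\hat P$ (an isomorphism of triples being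 an isomorphism of twists compatible with the identifications $\varphi,\hat\varphi$). Under this bijection $(T,\varphi,\hat\varphi)$ corresponds to the composite $$u\colon\; p^*P\cong p^*(T|_E)\cong\hat p^*(T|_{\hat E})\cong\hat p^*\hat P,$$ where the outer isomorphisms are given by $\varphi^{-1}$ and $\hat\varphi$ and the middle one is induced by the homotopy $(e,\hat e,s)\mapsto([e,\cos\tfrac{\pi s}{2}],[\hat e,\sin\tfrac{\pi s}{2}])$ from $i\circ p$ to $\hat\imath\circ\hat p$. (For a homotopy $c\colon Z\times[0,1]\to S$ this means the restriction to $Z\times\{1\}$ of the isomorphism $\mathrm{pr}^*c_0^*T\cong c^*T$ that restricts to the identity on $Z\times\{0\}$.) Moreover, if $(T,\varphi,\hat\varphi)$ and $(T',\varphi',\hat\varphi')$ correspond to $u$ and $u'$, then $T$ and $T'$ are isomorphic as twists on $S(E,\hat E)$, with no condition on the identifications, if and only if $u'=\hat p^*b\circ u\circ p^*a$ for some automorphisms $a$ of $P$ and $b$ of $\hat P$. -/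

import Mathlib

open CategoryTheory MonoidalCategory Topology

universe u v w

noncomputable section

namespace TDuality

/-! ### Spaces with an action of a topological group -/

/-- A `G`-space: a topological space with a continuous action of `G`. -/
structure GSpace (G : Type u) [Group G] [TopologicalSpace G] where
  carrier : Type u
  [top : TopologicalSpace carrier]
  [act : MulAction G carrier]
  [cont : ContinuousSMul G carrier]

attribute [instance] GSpace.top GSpace.act GSpace.cont

instance (G : Type u) [Group G] [TopologicalSpace G] : CoeSort (GSpace G) (Type u) :=
  ⟨GSpace.carrier⟩

variable {G : Type u} [Group G] [TopologicalSpace G]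

/-- A `G`-equivariant continuous map. -/
@[ext] structure GMap (X Y : GSpace G) where
  toFun : X → Y
  continuous' : Continuous toFun
  map_smul' : ∀ (g : G) (x : X), toFun (g • x) = g • toFun x

/-- The category of `G`-spaces and `G`-equivariant continuous maps. -/
instance : Category (GSpace G) where
  Hom X Y := GMap X Y
  id X := ⟨id, continuous_id, fun _ _ => rfl⟩
  comp f g := ⟨g.toFun ∘ f.toFun, g.continuous'.comp f.continuous',
    fun a x => by simp [f.map_smul', g.map_smul']⟩

/-- An invariant subset of a `G`-space, as a `G`-space. -/
def GSpace.sub (X : GSpace G) (s : Set X) (hs : ∀ (g : G), ∀ x ∈ s, g • x ∈ s) : GSpace G :=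
  letI : MulAction G s :=
    { smul := fun g x => ⟨g • (x : X), hs g x x.2⟩
      one_smul := fun x => Subtype.ext (one_smul G (x : X))
      mul_smul := fun a b x => Subtype.ext (mul_smul a b (x : X)) }
  haveI : ContinuousSMul G s :=
    ⟨Continuous.subtype_mk (continuous_fst.smul (continuous_subtype_val.comp continuous_snd)) _⟩
  ⟨s⟩

/-- The inclusion of an invariant subset into a larger one. -/
def GSpace.incl (X : GSpace G) {s t : Set X} (hs : ∀ (g : G), ∀ x ∈ s, g • x ∈ s)
    (ht : ∀ (g : G), ∀ x ∈ t, g • x ∈ t) (hst : s ⊆ t) : X.sub s hs ⟶ X.sub t ht :=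
  GMap.mk (X := X.sub s hs) (Y := X.sub t ht)
    (Set.inclusion hst) (continuous_inclusion hst) (fun _ _ => rfl)

/-- The inclusion of an invariant subset. -/
def GSpace.subι (X : GSpace G) (s : Set X) (hs : ∀ (g : G), ∀ x ∈ s, g • x ∈ s) :
    X.sub s hs ⟶ X :=
  GMap.mk (X := X.sub s hs) (Subtype.val) continuous_subtype_val (fun _ _ => rfl)

/-- The product `X × [0,1]`, where `G` acts trivially on `[0,1]`. -/
def GSpace.cyl (X : GSpace G) : GSpace G :=
  letI : MulAction G (X × unitInterval) :=
    { smul := fun g x => (g • x.1, x.2)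
      one_smul := fun x => Prod.ext (one_smul G x.1) rfl
      mul_smul := fun a b x => Prod.ext (mul_smul a b x.1) rfl }
  haveI : ContinuousSMul G (X × unitInterval) :=
    ⟨(continuous_fst.smul (continuous_fst.comp continuous_snd)).prodMk
      (continuous_snd.comp continuous_snd)⟩
  ⟨X × unitInterval⟩

/-- The projection `X × [0,1] → X`. -/
def GSpace.cylProj (X : GSpace G) : X.cyl ⟶ X :=
  GMap.mk (X := X.cyl) (Prod.fst) continuous_fst (fun _ _ => rfl)

/-- The inclusion `X → X × [0,1]` at height `s`. -/
def GSpace.cylι (X : GSpace G) (s : unitInterval) : X ⟶ X.cyl :=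
  GMap.mk (Y := X.cyl) (fun x => (x, s)) (continuous_id.prodMk continuous_const) (fun _ _ => rfl)

lemma GSpace.cylι_proj (X : GSpace G) (s : unitInterval) : X.cylι s ≫ X.cylProj = 𝟙 X := rfl

/-! ### The universal `G`-space, the Borel construction and Borel cohomology -/

/-- Milnor's universal `G`-space, the infinite join `G * G * ⋯`: its points are the formal convex
combinations `∑ tᵢ gᵢ`, where `gᵢ` is only remembered if `tᵢ ≠ 0`. -/
@[ext] structure MilnorE (G : Type u) where
  t : ℕ →₀ ℝ
  nonneg : ∀ i, 0 ≤ t i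
  sum_eq : t.sum (fun _ r => r) = 1
  pt : ∀ i, t i ≠ 0 → G

/-- Milnor's topology: the coarsest one for which the coordinates `tᵢ : EG → [0,1]` and
`gᵢ : {tᵢ ≠ 0} → G` are continuous (and `{tᵢ ≠ 0}` is open). -/
instance (G : Type u) [TopologicalSpace G] : TopologicalSpace (MilnorE G) :=
  TopologicalSpace.generateFrom
    ({A | ∃ (i : ℕ) (V : Set ℝ), IsOpen V ∧ A = {e | e.t i ∈ V}} ∪
     {A | ∃ (i : ℕ) (W : Set G), IsOpen W ∧ A = {e | ∃ h : e.t i ≠ 0, e.pt i h ∈ W}})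

instance (G : Type u) [Group G] : MulAction G (MilnorE G) where
  smul g e := ⟨e.t, e.nonneg, e.sum_eq, fun i h => g * e.pt i h⟩
  one_smul e := by
    apply MilnorE.ext
    · rfl
    · exact heq_of_eq (funext fun i => funext fun h => one_mul (e.pt i h))
  mul_smul a b e := by
    apply MilnorE.ext
    · rfl
    · exact heq_of_eq (funext fun i => funext fun h => mul_assoc a b (e.pt i h))

/-- The Borel construction `X ×_G EG`: the orbit space of the diagonal action on `X × EG`. -/
def borel : GSpace G ⥤ TopCat.{u} where
  obj X := TopCat.of (Quotient (MulAction.orbitRel G (X × MilnorE G)))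
  map {X Y} f := TopCat.ofHom
    ⟨Quotient.map' (s₁ := MulAction.orbitRel G (X × MilnorE G))
        (s₂ := MulAction.orbitRel G (Y × MilnorE G)) (Prod.map f.toFun id) (by
        rintro _ b ⟨g, rfl⟩
        exact ⟨g, Prod.ext (f.map_smul' g b.1).symm rfl⟩),
      Continuous.quotient_map' (f.continuous'.prodMap continuous_id) _⟩
  map_id X := by
    ext x
    induction x using Quotient.inductionOn
    rfl
  map_comp f g := by
    ext x
    induction x using Quotient.inductionOn
    rfl

/-- Singular cohomology `Hⁿ(Y; ℤ)`: the cohomology of `Hom(C_•(Y), ℤ)`. -/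
def singularCohomology (n : ℕ) : TopCat.{u}ᵒᵖ ⥤ AddCommGrpCat.{u} :=
  ((AlgebraicTopology.singularChainComplexFunctor AddCommGrpCat.{u}).obj
      (AddCommGrpCat.of (ULift.{u} ℤ))).op ⋙
    HomologicalComplex.opFunctor AddCommGrpCat.{u} (ComplexShape.down ℕ) ⋙
    (preadditiveYoneda.obj (AddCommGrpCat.of (ULift.{u} ℤ))).mapHomologicalComplex _ ⋙
    HomologicalComplex.homologyFunctor _ _ n

/-- Borel cohomology `Hⁿ_G(X; ℤ) = Hⁿ(X ×_G EG; ℤ)`. -/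
def borelCohomology (n : ℕ) : (GSpace G)ᵒᵖ ⥤ AddCommGrpCat.{u} :=
  borel.op ⋙ singularCohomology n

/-! ### Models for equivariant twists -/

/-- A model for `G`-equivariant twists. It consists of a presheaf of monoidal groupoids `Tw` on
the category of `G`-spaces (pullbacks are functorial up to coherent monoidal isomorphisms), such
that isomorphism classes of twists are classified by `H³_G(X; ℤ)`, automorphisms of the
trivial twist are classified by `H²_G(X; ℤ)`, and twists can be glued along isomorphisms.
These properties are only required on a class `Good` of `G`-spaces (which may be the class of all
`G`-spaces), closed under passage to invariant open subspaces and products with `[0,1]`. -/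
structure TwistModel (G : Type u) [Group G] [TopologicalSpace G] where
  /-- The groupoid of `G`-equivariant twists on `X`. -/
  Tw : GSpace G → Type w
  [groupoid : ∀ X, Groupoid.{v} (Tw X)]
  [monoidal : ∀ X, MonoidalCategory (Tw X)]
  /-- The pullback of twists. -/
  pull : ∀ {X Y : GSpace G}, (X ⟶ Y) → (Tw Y ⥤ Tw X)
  [pullMonoidal : ∀ {X Y : GSpace G} (f : X ⟶ Y), (pull f).Monoidal]
  pullId : ∀ X : GSpace G, pull (𝟙 X) ≅ 𝟭 (Tw X)
  pullComp : ∀ {X Y Z : GSpace G} (f : X ⟶ Y) (g : Y ⟶ Z), pull (f ≫ g) ≅ pull g ⋙ pull f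
  pullId_monoidal : ∀ X : GSpace G, NatTrans.IsMonoidal (pullId X).hom
  pullComp_monoidal : ∀ {X Y Z : GSpace G} (f : X ⟶ Y) (g : Y ⟶ Z),
    NatTrans.IsMonoidal (pullComp f g).hom
  /-- Coherence of the pullbacks. -/
  pull_id_comp : ∀ {X Y : GSpace G} (f : X ⟶ Y) (P : Tw Y),
    (pullComp (𝟙 X) f).hom.app P ≫ (pullId X).hom.app ((pull f).obj P) =
      eqToHom (by rw [Category.id_comp]; rfl)
  pull_comp_id : ∀ {X Y : GSpace G} (f : X ⟶ Y) (P : Tw Y),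
    (pullComp f (𝟙 Y)).hom.app P ≫ (pull f).map ((pullId Y).hom.app P) =
      eqToHom (by rw [Category.comp_id]; rfl)
  pull_assoc : ∀ {W X Y Z : GSpace G} (f : W ⟶ X) (g : X ⟶ Y) (h : Y ⟶ Z) (P : Tw Z),
    (pullComp (f ≫ g) h).hom.app P ≫ (pullComp f g).hom.app ((pull h).obj P) =
      eqToHom (by rw [Category.assoc]) ≫
        (pullComp f (g ≫ h)).hom.app P ≫ (pull f).map ((pullComp g h).hom.app P)
  /-- The class of spaces under consideration. -/
  Good : GSpace G → Prop
  good_open : ∀ (X : GSpace G) (U : Set X) (hU : ∀ (g : G), ∀ x ∈ U, g • x ∈ U),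
    Good X → IsOpen U → Good (X.sub U hU)
  good_cyl : ∀ X : GSpace G, Good X → Good X.cyl
  /-- The characteristic class `[P] ∈ H³_G(X; ℤ)`, a monoidal natural transformation that
  classifies twists up to isomorphism. -/
  cls : ∀ {X : GSpace G}, Tw X → (borelCohomology 3).obj (Opposite.op X)
  cls_pull : ∀ {X Y : GSpace G} (f : X ⟶ Y) (P : Tw Y), Good X → Good Y →
    cls ((pull f).obj P) = (borelCohomology 3).map f.op (cls P)
  cls_tensor : ∀ {X : GSpace G} (P Q : Tw X), Good X → cls (P ⊗ Q) = cls P + cls Q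
  cls_unit : ∀ {X : GSpace G}, Good X → cls (𝟙_ (Tw X)) = 0
  cls_eq_iff : ∀ {X : GSpace G} (P Q : Tw X), Good X → (cls P = cls Q ↔ Nonempty (P ≅ Q))
  cls_surjective : ∀ {X : GSpace G}, Good X → Function.Surjective (cls : Tw X → _)
  /-- The natural isomorphism between the group of automorphisms of the trivial twist and
  `H²_G(X; ℤ)`. -/
  autCls : ∀ {X : GSpace G}, Good X →
    ((𝟙_ (Tw X) ≅ 𝟙_ (Tw X)) ≃ (borelCohomology 2).obj (Opposite.op X))
  autCls_trans : ∀ {X : GSpace G} (hX : Good X) (a b : 𝟙_ (Tw X) ≅ 𝟙_ (Tw X)),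
    autCls hX (a ≪≫ b) = autCls hX a + autCls hX b
  autCls_pull : ∀ {X Y : GSpace G} (f : X ⟶ Y) (hX : Good X) (hY : Good Y)
    (a : 𝟙_ (Tw Y) ≅ 𝟙_ (Tw Y)),
    autCls hX (Functor.Monoidal.εIso (pull f) ≪≫ (pull f).mapIso a ≪≫
      (Functor.Monoidal.εIso (pull f)).symm) = (borelCohomology 2).map f.op (autCls hY a)
  /-- Gluing: if `X = U ∪ V` with `U`, `V` open and invariant, then twists on `U` and `V` and an
  isomorphism `u` between their restrictions to `U ∩ V` come from a twist `P` on `X`. -/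
  glue : ∀ (X : GSpace G) (U V : Set X) (hU : ∀ (g : G), ∀ x ∈ U, g • x ∈ U)
    (hV : ∀ (g : G), ∀ x ∈ V, g • x ∈ V) (hUV : ∀ (g : G), ∀ x ∈ U ∩ V, g • x ∈ U ∩ V),
    Good X → IsOpen U → IsOpen V → U ∪ V = Set.univ →
    ∀ (PU : Tw (X.sub U hU)) (PV : Tw (X.sub V hV))
      (u : (pull (X.incl hUV hU Set.inter_subset_left)).obj PU ≅
        (pull (X.incl hUV hV Set.inter_subset_right)).obj PV),
    ∃ (P : Tw X) (ψU : (pull (X.subι U hU)).obj P ≅ PU) (ψV : (pull (X.subι V hV)).obj P ≅ PV),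
      (pullComp (X.incl hUV hU Set.inter_subset_left) (X.subι U hU)).hom.app P ≫
          (pull (X.incl hUV hU Set.inter_subset_left)).map ψU.hom ≫ u.hom =
        (pullComp (X.incl hUV hV Set.inter_subset_right) (X.subι V hV)).hom.app P ≫
          (pull (X.incl hUV hV Set.inter_subset_right)).map ψV.hom
  /-- The glued twist, with its identifications over `U` and `V`, is unique up to
  isomorphism. -/
  glue_unique : ∀ (X : GSpace G) (U V : Set X) (hU : ∀ (g : G), ∀ x ∈ U, g • x ∈ U)
    (hV : ∀ (g : G), ∀ x ∈ V, g • x ∈ V) (hUV : ∀ (g : G), ∀ x ∈ U ∩ V, g • x ∈ U ∩ V),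
    Good X → IsOpen U → IsOpen V → U ∪ V = Set.univ →
    ∀ (PU : Tw (X.sub U hU)) (PV : Tw (X.sub V hV))
      (u : (pull (X.incl hUV hU Set.inter_subset_left)).obj PU ≅
        (pull (X.incl hUV hV Set.inter_subset_right)).obj PV)
      (P P' : Tw X)
      (ψU : (pull (X.subι U hU)).obj P ≅ PU) (ψV : (pull (X.subι V hV)).obj P ≅ PV)
      (ψU' : (pull (X.subι U hU)).obj P' ≅ PU) (ψV' : (pull (X.subι V hV)).obj P' ≅ PV),
      (pullComp (X.incl hUV hU Set.inter_subset_left) (X.subι U hU)).hom.app P ≫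
          (pull (X.incl hUV hU Set.inter_subset_left)).map ψU.hom ≫ u.hom =
        (pullComp (X.incl hUV hV Set.inter_subset_right) (X.subι V hV)).hom.app P ≫
          (pull (X.incl hUV hV Set.inter_subset_right)).map ψV.hom →
      (pullComp (X.incl hUV hU Set.inter_subset_left) (X.subι U hU)).hom.app P' ≫
          (pull (X.incl hUV hU Set.inter_subset_left)).map ψU'.hom ≫ u.hom =
        (pullComp (X.incl hUV hV Set.inter_subset_right) (X.subι V hV)).hom.app P' ≫
          (pull (X.incl hUV hV Set.inter_subset_right)).map ψV'.hom →
      ∃ θ : P ≅ P', (pull (X.subι U hU)).map θ.hom ≫ ψU'.hom = ψU.hom ∧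
        (pull (X.subι V hV)).map θ.hom ≫ ψV'.hom = ψV.hom

attribute [instance] TwistModel.groupoid TwistModel.monoidal TwistModel.pullMonoidal

/-- The canonical isomorphism `h^*P ≅ f^*(g^*P)` for `h = g ∘ f`. -/
def TwistModel.pullTri (M : TwistModel.{u, v, w} G) {A B C : GSpace G} {f : A ⟶ B} {g : B ⟶ C}
    {h : A ⟶ C} (e : f ≫ g = h) (P : M.Tw C) :
    (M.pull h).obj P ≅ (M.pull f).obj ((M.pull g).obj P) :=
  eqToIso (by rw [e]) ≪≫ (M.pullComp f g).app P

/-! ### Circle bundles and the sphere bundle -/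

/-- A `G`-equivariant principal `S¹`-bundle over `X`. -/
structure CircleBundle (X : GSpace G) where
  tot : GSpace G
  proj : tot ⟶ X
  [circAct : MulAction Circle tot]
  [circCont : ContinuousSMul Circle tot]
  [comm : SMulCommClass G Circle tot]
  locTriv : ∀ x : X, ∃ V : Set X, IsOpen V ∧ x ∈ V ∧
    ∃ h : V × Circle ≃ₜ (proj.toFun ⁻¹' V : Set tot),
      (∀ y z, proj.toFun (h (y, z)) = y) ∧
      (∀ y z z', (h (y, z * z') : tot) = z • (h (y, z') : tot))

attribute [instance] CircleBundle.circAct CircleBundle.circCont CircleBundle.comm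

namespace CircleBundle

variable {X : GSpace G} (E F : CircleBundle X)

lemma proj_smul (z : Circle) (e : E.tot) : E.proj.toFun (z • e) = E.proj.toFun e := by
  obtain ⟨V, -, hx, h, h1, h2⟩ := E.locTriv (E.proj.toFun e)
  obtain ⟨⟨y, z'⟩, hy⟩ := h.surjective ⟨e, hx⟩
  have : e = h (y, z') := by rw [hy]
  rw [this, ← h2, h1, h1]

lemma exists_smul_eq (e e' : E.tot) (hee : E.proj.toFun e = E.proj.toFun e') :
    ∃ z : Circle, z • e = e' := by
  obtain ⟨V, -, hx, h, h1, h2⟩ := E.locTriv (E.proj.toFun e)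
  obtain ⟨⟨y, z⟩, hy⟩ := h.surjective ⟨e, hx⟩
  obtain ⟨⟨y', z'⟩, hy'⟩ := h.surjective ⟨e', by rw [hee] at hx; exact hx⟩
  have he : e = h (y, z) := by rw [hy]
  have he' : e' = h (y', z') := by rw [hy']
  have : y = y' := by
    apply Subtype.ext
    rw [← h1 y z, ← h1 y' z', ← he, ← he', hee]
  subst this
  refine ⟨z' * z⁻¹, ?_⟩
  rw [he, he', ← h2]
  simp

lemma proj_surjective : Function.Surjective E.proj.toFun := by
  intro x
  obtain ⟨V, -, hx, h, h1, -⟩ := E.locTriv x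
  exact ⟨h (⟨x, hx⟩, 1), h1 _ _⟩

/-- Identify `(z • e, c)` with `(e, z * c)`. -/
def lineSetoid : Setoid (E.tot × ℂ) where
  r a b := ∃ z : Circle, b.1 = z • a.1 ∧ a.2 = z * b.2
  iseqv :=
    { refl := fun a => ⟨1, by simp, by simp⟩
      symm := by
        rintro a b ⟨z, h1, h2⟩
        refine ⟨z⁻¹, by simp [h1], ?_⟩
        rw [h2, ← mul_assoc, ← Circle.coe_mul]
        simp
      trans := by
        rintro a b c ⟨z, h1, h2⟩ ⟨z', h3, h4⟩
        refine ⟨z' * z, by rw [h3, h1, mul_smul], ?_⟩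
        rw [h2, h4, ← mul_assoc, ← Circle.coe_mul, mul_comm z z'] }

/-- The total space of the associated line bundle `E ×_{S¹} ℂ`. -/
def Line : Type u := Quotient E.lineSetoid

instance : TopologicalSpace E.Line := inferInstanceAs (TopologicalSpace (Quotient E.lineSetoid))

/-- The class `[e, c]`. -/
def lmk (a : E.tot × ℂ) : E.Line := Quotient.mk E.lineSetoid a

lemma continuous_lmk : Continuous E.lmk := continuous_quotient_mk'

lemma lmk_surjective : Function.Surjective E.lmk := Quotient.exists_rep

lemma isOpenQuotientMap_lmk : IsOpenQuotientMap E.lmk := by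
  refine ⟨E.lmk_surjective, E.continuous_lmk, fun W hW => ?_⟩
  have hq : IsQuotientMap E.lmk := isQuotientMap_quotient_mk'
  rw [← hq.isOpen_preimage]
  have : E.lmk ⁻¹' (E.lmk '' W) =
      ⋃ z : Circle, (fun a : E.tot × ℂ => (z • a.1, (z⁻¹ : Circle) * a.2)) ⁻¹' W := by
    ext a
    simp only [Set.mem_preimage, Set.mem_image, Set.mem_iUnion]
    constructor
    · rintro ⟨b, hb, hab⟩
      obtain ⟨z, h1, h2⟩ := E.lineSetoid.symm (Quotient.exact hab)
      refine ⟨z, ?_⟩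
      have : (z • a.1, ((z⁻¹ : Circle) : ℂ) * a.2) = b := by
        refine Prod.ext h1.symm ?_
        simp only [h2]
        rw [← mul_assoc, ← Circle.coe_mul]
        simp
      rw [this]
      exact hb
    · rintro ⟨z, hz⟩
      refine ⟨_, hz, Quotient.sound (E.lineSetoid.symm ⟨z, rfl, ?_⟩)⟩
      rw [← mul_assoc, ← Circle.coe_mul]
      simp
  rw [this]
  refine isOpen_iUnion fun z => hW.preimage ?_
  exact ((continuous_const_smul z).comp continuous_fst).prodMk
    (continuous_const.mul continuous_snd)

instance : MulAction G E.Line where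
  smul g := Quotient.map' (s₁ := E.lineSetoid) (s₂ := E.lineSetoid) (fun a => (g • a.1, a.2)) (by
    rintro a b ⟨z, h1, h2⟩
    exact ⟨z, by rw [h1, smul_comm], h2⟩)
  one_smul l := by
    obtain ⟨a, rfl⟩ := E.lmk_surjective l
    exact congrArg E.lmk (Prod.ext (one_smul G a.1) rfl)
  mul_smul g h l := by
    obtain ⟨a, rfl⟩ := E.lmk_surjective l
    exact congrArg E.lmk (Prod.ext (mul_smul g h a.1) rfl)

lemma smul_lmk (g : G) (a : E.tot × ℂ) : g • E.lmk a = E.lmk (g • a.1, a.2) := rfl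

instance : ContinuousSMul G E.Line := by
  refine ⟨?_⟩
  have hq := (IsOpenQuotientMap.id (X := G)).prodMap E.isOpenQuotientMap_lmk
  rw [hq.isQuotientMap.continuous_iff]
  change Continuous fun x : G × (E.tot × ℂ) => E.lmk (x.1 • x.2.1, x.2.2)
  exact E.continuous_lmk.comp (by fun_prop)

/-- The projection `E ×_{S¹} ℂ → X`. -/
def lineProj : E.Line → X :=
  Quotient.lift (s := E.lineSetoid) (fun a => E.proj.toFun a.1) (by
    rintro a b ⟨z, h1, -⟩
    simp only [h1, proj_smul])

/-- The norm `|[e, c]| = |c|` on the fibres of `E ×_{S¹} ℂ`. -/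
def lineNorm : E.Line → ℝ :=
  Quotient.lift (s := E.lineSetoid) (fun a => ‖a.2‖) (by
    rintro a b ⟨z, -, h2⟩
    simp [h2, Circle.norm_coe])

lemma lineProj_smul (g : G) (l : E.Line) : E.lineProj (g • l) = g • E.lineProj l := by
  obtain ⟨a, rfl⟩ := E.lmk_surjective l
  exact E.proj.map_smul' g a.1

lemma lineNorm_smul (g : G) (l : E.Line) : E.lineNorm (g • l) = E.lineNorm l := by
  obtain ⟨a, rfl⟩ := E.lmk_surjective l
  rfl

/-- The zero section of `E ×_{S¹} ℂ`. -/
def zero (x : X) : E.Line := E.lmk ((E.proj_surjective x).choose, 0)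

lemma zero_proj (e : E.tot) : E.zero (E.proj.toFun e) = E.lmk (e, 0) := by
  obtain ⟨z, hz⟩ := E.exists_smul_eq _ e (E.proj_surjective (E.proj.toFun e)).choose_spec
  exact Quotient.sound ⟨z, hz.symm, by simp⟩

lemma continuous_zero : Continuous E.zero := by
  rw [continuous_iff_continuousAt]
  intro x
  obtain ⟨V, hV, hx, h, h1, -⟩ := E.locTriv x
  refine ContinuousOn.continuousAt (s := V) ?_ (hV.mem_nhds hx)
  rw [continuousOn_iff_continuous_domRestrict]
  have : V.domRestrict E.zero = fun y : V => E.lmk ((h (y, 1) : E.tot), 0) := by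
    funext y
    rw [← zero_proj, h1]
    rfl
  rw [this]
  exact E.continuous_lmk.comp (by fun_prop)

lemma lineProj_zero (x : X) : E.lineProj (E.zero x) = x := (E.proj_surjective x).choose_spec

lemma lineNorm_zero (x : X) : E.lineNorm (E.zero x) = 0 := norm_zero

lemma zero_smul (g : G) (x : X) : E.zero (g • x) = g • E.zero x := by
  obtain ⟨e, rfl⟩ := E.proj_surjective x
  rw [← E.proj.map_smul', zero_proj, zero_proj, smul_lmk]

/-- The fibre product `E ×_X F`, with the diagonal action of `G`. -/
def fiberProd : GSpace G :=
  GSpace.sub (GSpace.mk (E.tot × F.tot)) {a | E.proj.toFun a.1 = F.proj.toFun a.2} (by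
    rintro g ⟨a, b⟩ h
    change E.proj.toFun (g • a) = F.proj.toFun (g • b)
    rw [E.proj.map_smul', F.proj.map_smul']
    exact congrArg (g • ·) h)

/-- The projection `p : E ×_X F → E`. -/
def fst : fiberProd E F ⟶ E.tot :=
  GMap.mk (X := fiberProd E F) (fun a => a.1.1) (continuous_fst.comp continuous_subtype_val)
    (fun _ _ => rfl)

/-- The projection `p̂ : E ×_X F → F`. -/
def snd : fiberProd E F ⟶ F.tot :=
  GMap.mk (X := fiberProd E F) (fun a => a.1.2) (continuous_snd.comp continuous_subtype_val)
    (fun _ _ => rfl)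

/-- The sphere bundle `S(E, F)` of `(E ×_{S¹} ℂ) ⊕ (F ×_{S¹} ℂ)`. -/
def sphere : GSpace G :=
  GSpace.sub (GSpace.mk (E.Line × F.Line))
    {l | E.lineProj l.1 = F.lineProj l.2 ∧ E.lineNorm l.1 ^ 2 + F.lineNorm l.2 ^ 2 = 1} (by
    rintro g ⟨a, b⟩ ⟨h1, h2⟩
    refine ⟨?_, ?_⟩
    · change E.lineProj (g • a) = F.lineProj (g • b)
      rw [lineProj_smul, lineProj_smul]
      exact congrArg (g • ·) h1
    · change E.lineNorm (g • a) ^ 2 + F.lineNorm (g • b) ^ 2 = 1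
      rw [lineNorm_smul, lineNorm_smul]
      exact h2)

/-- The inclusion `E → S(E, F)`, `e ↦ ([e, 1], 0)`. -/
def inl : E.tot ⟶ sphere E F :=
  GMap.mk (Y := sphere E F)
    (fun e => ⟨(E.lmk (e, 1), F.zero (E.proj.toFun e)),
      (F.lineProj_zero _).symm, by rw [F.lineNorm_zero]; simp [lineNorm, lmk]⟩)
    (Continuous.subtype_mk ((E.continuous_lmk.comp (by fun_prop)).prodMk
      (F.continuous_zero.comp E.proj.continuous')) _)
    (fun g e => Subtype.ext (Prod.ext rfl (by
      change F.zero (E.proj.toFun (g • e)) = g • F.zero (E.proj.toFun e)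
      rw [E.proj.map_smul', zero_smul])))

/-- The inclusion `F → S(E, F)`, `f ↦ (0, [f, 1])`. -/
def inr : F.tot ⟶ sphere E F :=
  GMap.mk (Y := sphere E F)
    (fun f => ⟨(E.zero (F.proj.toFun f), F.lmk (f, 1)),
      E.lineProj_zero _, by rw [E.lineNorm_zero]; simp [lineNorm, lmk]⟩)
    (Continuous.subtype_mk ((E.continuous_zero.comp F.proj.continuous').prodMk
      (F.continuous_lmk.comp (by fun_prop))) _)
    (fun g f => Subtype.ext (Prod.ext (by
      change E.zero (F.proj.toFun (g • f)) = g • E.zero (F.proj.toFun f)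
      rw [F.proj.map_smul', zero_smul]) rfl))

/-- The map `(E ×_X F) × [0,1] → S(E, F)`, `(e, f, s) ↦ ([e, cos (πs/2)], [f, sin (πs/2)])`, which
exhibits `S(E, F)` as the union of the mapping cylinders of `p` and `p̂`. It is a homotopy from
`E ×_X F → E → S(E, F)` to `E ×_X F → F → S(E, F)`. -/
def join : (fiberProd E F).cyl ⟶ sphere E F :=
  GMap.mk (X := (fiberProd E F).cyl) (Y := sphere E F)
    (fun a => ⟨(E.lmk (a.1.1.1, (Real.cos (Real.pi * a.2 / 2) : ℂ)),
        F.lmk (a.1.1.2, (Real.sin (Real.pi * a.2 / 2) : ℂ))),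
      a.1.2, by
        change ‖(Real.cos (Real.pi * a.2 / 2) : ℂ)‖ ^ 2 +
          ‖(Real.sin (Real.pi * a.2 / 2) : ℂ)‖ ^ 2 = 1
        rw [Complex.norm_real, Complex.norm_real, Real.norm_eq_abs, Real.norm_eq_abs, sq_abs,
          sq_abs, Real.cos_sq_add_sin_sq]⟩)
    (by
      have h1 : Continuous fun a : (fiberProd E F) × unitInterval => a.1.1.1 :=
        (fst E F).continuous'.comp continuous_fst
      have h2 : Continuous fun a : (fiberProd E F) × unitInterval => a.1.1.2 :=
        (snd E F).continuous'.comp continuous_fst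
      have h3 : Continuous fun a : (fiberProd E F) × unitInterval => (a.2 : ℝ) := by fun_prop
      exact Continuous.subtype_mk
        ((E.continuous_lmk.comp (h1.prodMk (by fun_prop))).prodMk
          (F.continuous_lmk.comp (h2.prodMk (by fun_prop)))) _)
    (fun _ _ => rfl)

lemma join_zero : (fiberProd E F).cylι 0 ≫ join E F = fst E F ≫ inl E F := by
  apply GMap.ext
  funext a
  refine Subtype.ext (Prod.ext ?_ ?_)
  · change E.lmk (a.1.1, ((Real.cos (Real.pi * (0 : ℝ) / 2) : ℝ) : ℂ)) = E.lmk (a.1.1, 1)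
    simp
  · change F.lmk (a.1.2, ((Real.sin (Real.pi * (0 : ℝ) / 2) : ℝ) : ℂ)) =
      F.zero (E.proj.toFun a.1.1)
    have h : E.proj.toFun a.1.1 = F.proj.toFun a.1.2 := a.2
    rw [h, zero_proj]
    simp

lemma join_one : (fiberProd E F).cylι 1 ≫ join E F = snd E F ≫ inr E F := by
  apply GMap.ext
  funext a
  refine Subtype.ext (Prod.ext ?_ ?_)
  · change E.lmk (a.1.1, ((Real.cos (Real.pi * (1 : ℝ) / 2) : ℝ) : ℂ)) =
      E.zero (F.proj.toFun a.1.2)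
    have h : E.proj.toFun a.1.1 = F.proj.toFun a.1.2 := a.2
    rw [← h, zero_proj]
    simp
  · change F.lmk (a.1.2, ((Real.sin (Real.pi * (1 : ℝ) / 2) : ℝ) : ℂ)) = F.lmk (a.1.2, 1)
    simp

end CircleBundle

open CircleBundle

/-! ### Twists on the sphere bundle with prescribed restrictions -/

section

variable (M : TwistModel.{u, v, w} G) {X : GSpace G} {E F : CircleBundle X}

/-- A twist on `S(E, F)` whose restrictions to `E` and `F` are (identified with) `P` and `Q`. -/
structure SphereTwist (P : M.Tw E.tot) (Q : M.Tw F.tot) where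
  tw : M.Tw (sphere E F)
  resl : (M.pull (inl E F)).obj tw ≅ P
  resr : (M.pull (inr E F)).obj tw ≅ Q

variable {M}

/-- Isomorphism of twists on `S(E, F)`, compatible with the restrictions to `E` and `F`. -/
instance sphereTwistSetoid (P : M.Tw E.tot) (Q : M.Tw F.tot) : Setoid (SphereTwist M P Q) where
  r T T' := ∃ θ : T.tw ≅ T'.tw,
    (M.pull (inl E F)).map θ.hom ≫ T'.resl.hom = T.resl.hom ∧
    (M.pull (inr E F)).map θ.hom ≫ T'.resr.hom = T.resr.hom
  iseqv :=
    { refl := fun T => ⟨Iso.refl _, by simp, by simp⟩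
      symm := by
        rintro T T' ⟨θ, h1, h2⟩
        refine ⟨θ.symm, ?_, ?_⟩
        · rw [← h1, ← Category.assoc, ← Functor.map_comp]
          simp
        · rw [← h2, ← Category.assoc, ← Functor.map_comp]
          simp
      trans := by
        rintro T T' T'' ⟨θ, h1, h2⟩ ⟨θ', h3, h4⟩
        refine ⟨θ ≪≫ θ', ?_, ?_⟩
        · rw [← h1, ← h3]
          simp
        · rw [← h2, ← h4]
          simp }

/-- For an isomorphism `Θ : pr^*R ≅ c^*T` over `Z × [0,1]` and `c(-, s) = i ∘ q`, the restriction
`R ≅ q^*(i^*T)` of `Θ` to `Z × {s}`. -/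
def slice {Z A S : GSpace G} {R : M.Tw Z} {T : M.Tw S} {c : Z.cyl ⟶ S}
    (Θ : (M.pull Z.cylProj).obj R ≅ (M.pull c).obj T) (s : unitInterval)
    {q : Z ⟶ A} {i : A ⟶ S} (h : Z.cylι s ≫ c = q ≫ i) :
    R ≅ (M.pull q).obj ((M.pull i).obj T) :=
  ((M.pullId Z).app R).symm ≪≫ M.pullTri (Z.cylι_proj s) R ≪≫
    (M.pull (Z.cylι s)).mapIso Θ ≪≫ (M.pullTri h T).symm ≪≫ (M.pullComp q i).app T

/-- `u : p^*P ≅ p̂^*Q` is the composite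
`p^*P ≅ p^*(T|_E) ≅ p̂^*(T|_F) ≅ p̂^*Q`, where the middle isomorphism is induced by the homotopy
`join E F` between `E ×_X F → E → S(E, F)` and `E ×_X F → F → S(E, F)`. -/
def Induces {P : M.Tw E.tot} {Q : M.Tw F.tot} (T : SphereTwist M P Q)
    (u : (M.pull (fst E F)).obj P ≅ (M.pull (snd E F)).obj Q) : Prop :=
  ∃ Θ : (M.pull (fiberProd E F).cylProj).obj ((M.pull (fst E F)).obj P) ≅
      (M.pull (join E F)).obj T.tw,
    slice Θ 0 (join_zero E F) ≪≫ (M.pull (fst E F)).mapIso T.resl = Iso.refl _ ∧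
    slice Θ 1 (join_one E F) ≪≫ (M.pull (snd E F)).mapIso T.resr = u

end

end TDuality

end

open TDuality CircleBundle

noncomputable section

namespace TDuality

variable {G : Type u} [Group G] [TopologicalSpace G]

/-! ### Homotopy invariance of Borel cohomology -/

/-! The argument is unique homotopy lifting followed by a Mayer-Vietoris gluing. Borel cohomology is
homotopy invariant. Twists are tensor-invertible, so the automorphisms of any twist form a copy of
`H²_G`. Restriction from `Z × [0,1]` to `Z × {0}` is therefore bijective on morphisms of twists:
`H³_G` supplies some isomorphism over the cylinder, and `H²_G` corrects it uniquely
(`bijective_map_pull_cylι'`).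

The bookkeeping takes place in the category of pairs `(X, P)`, where a morphism is a map `f` with an
isomorphism `P ≅ f^*Q`. Every morphism there is cartesian, so morphisms can be lifted and cancelled,
and a homotopy has exactly one lift with a given start (`exists_cyl_lift`, `cyl_ext`). Lifting the
join homotopy attaches to each `(T, φ, φ̂)` exactly one `u`.

The sphere bundle is covered by two invariant open sets, the complements of `Ê` and of `E`. They
deformation retract onto `E` and `Ê`, and their overlap maps to `E ×_X Ê`. Given `u`, the pullbacks
of `P` and `P̂` along the retractions are glued over the overlap by the pullback of `u`; sliding
from the middle of the join to its top shows that the result induces `u`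
(`exists_sphereTwist_induces`). Conversely, if `T` induces `u`, its identifications over `E` and `Ê`
extend over the charts (`exists_extension`). On the overlap both extensions agree with the lifted
join homotopy (`comparison_left`, `comparison_right`), so `T` solves that same gluing problem and is
unique up to isomorphism (`equiv_of_induces`).

For the last clause, an isomorphism of underlying twists misses the identifications by automorphisms
of `P` and `P̂`, and changing the identifications conjugates `u` (`Induces.conj`). -/

lemma singularCohomology_map_eq_of_homotopy {X Y : TopCat.{u}} {f g : X ⟶ Y}
    (H : TopCat.Homotopy f g) (n : ℕ) :
    (singularCohomology n).map f.op = (singularCohomology n).map g.op :=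
  ((preadditiveYoneda.obj (AddCommGrpCat.of (ULift.{u} ℤ))).mapHomotopy
    (H.singularChainComplexFunctorObjMap (AddCommGrpCat.of (ULift.{u} ℤ))).op).homologyMap_eq n

/-- Continuity of each single translation is enough to make the projection to the orbit space open;
joint continuity of the action is not needed. -/
instance [IsTopologicalGroup G] : ContinuousConstSMul G (MilnorE G) where
  continuous_const_smul g := by
    refine continuous_generateFrom_iff.2 ?_
    rintro A (⟨i, V, hV, rfl⟩ | ⟨i, W, hW, rfl⟩)
    · exact TopologicalSpace.isOpen_generateFrom_of_mem (Or.inl ⟨i, V, hV, rfl⟩)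
    · exact TopologicalSpace.isOpen_generateFrom_of_mem
        (Or.inr ⟨i, _, hW.preimage (continuous_const_mul g), rfl⟩)

/-- An equivariant homotopy induces a homotopy on Borel constructions. -/
def borelHomotopy [IsTopologicalGroup G] {X Y : GSpace G} (H : X.cyl ⟶ Y) :
    TopCat.Homotopy (borel.map (X.cylι 0 ≫ H)) (borel.map (X.cylι 1 ≫ H)) where
  toFun a := Quotient.map' (s₁ := MulAction.orbitRel G (X × MilnorE G))
    (s₂ := MulAction.orbitRel G (Y × MilnorE G))
    (fun b => (H.toFun ((b.1, a.1) : X × unitInterval), b.2)) (by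
      rintro _ b ⟨g, rfl⟩
      exact ⟨g, Prod.ext (H.map_smul' g ((b.1, a.1) : X × unitInterval)).symm rfl⟩) a.2
  continuous_toFun := by
    -- The orbit projection is open, so its product with `[0,1]` is still a quotient map and
    -- continuity may be checked before passing to orbits.
    have hq := (IsOpenQuotientMap.id (X := unitInterval)).prodMap
      (MulAction.isOpenQuotientMap_quotientMk (Γ := G) (T := X × MilnorE G))
    refine hq.isQuotientMap.continuous_iff.2 ?_
    have h : Continuous fun a : unitInterval × (X × MilnorE G) =>
        (H.toFun ((a.2.1, a.1) : X × unitInterval), a.2.2) :=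
      (H.continuous'.comp ((continuous_fst.comp continuous_snd).prodMk continuous_fst)).prodMk
        (continuous_snd.comp continuous_snd)
    exact (continuous_quotient_mk' (s := MulAction.orbitRel G (Y × MilnorE G))).comp h
  map_zero_left b := by
    induction b using Quotient.inductionOn
    rfl
  map_one_left b := by
    induction b using Quotient.inductionOn
    rfl

lemma borelCohomology_map_eq_of_homotopy [IsTopologicalGroup G] {X Y : GSpace G}
    (H : X.cyl ⟶ Y) (n : ℕ) :
    (borelCohomology n).map (X.cylι 0 ≫ H).op = (borelCohomology n).map (X.cylι 1 ≫ H).op :=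
  singularCohomology_map_eq_of_homotopy (borelHomotopy H) n

/-- The contraction `((x, s), t) ↦ (x, s t)` of `X × [0,1]` onto `X × {0}`. -/
def GSpace.cylContract (X : GSpace G) : X.cyl.cyl ⟶ X.cyl :=
  GMap.mk (X := X.cyl.cyl) (Y := X.cyl)
    (fun a : (X × unitInterval) × unitInterval => (a.1.1, a.1.2 * a.2))
    (show Continuous fun a : (X × unitInterval) × unitInterval => (a.1.1, a.1.2 * a.2) by fun_prop)
    (fun _ _ => rfl)

/-- `cylContract` joins the retraction onto the bottom to the identity, so the projection and the
bottom inclusion induce inverse maps. -/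
lemma bijective_borelCohomology_map_cylι [IsTopologicalGroup G] (X : GSpace G) (n : ℕ) :
    Function.Bijective ((borelCohomology n).map (X.cylι 0).op) := by
  have h0 : X.cyl.cylι 0 ≫ X.cylContract = X.cylProj ≫ X.cylι 0 :=
    GMap.ext (funext fun a : X × unitInterval => Prod.ext rfl (mul_zero a.2))
  have h1 : X.cyl.cylι 1 ≫ X.cylContract = 𝟙 _ :=
    GMap.ext (funext fun a : X × unitInterval => Prod.ext rfl (mul_one a.2))
  have h := borelCohomology_map_eq_of_homotopy X.cylContract n
  rw [h0, h1, op_comp, op_id, Functor.map_comp, CategoryTheory.Functor.map_id] at h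
  have h' : (borelCohomology n).map X.cylProj.op ≫ (borelCohomology n).map (X.cylι 0).op = 𝟙 _ := by
    rw [← Functor.map_comp, ← op_comp, X.cylι_proj, op_id, CategoryTheory.Functor.map_id]
  exact Function.bijective_iff_has_inverse.2 ⟨(borelCohomology n).map X.cylProj.op,
    fun x => congr($h x), fun x => congr($h' x)⟩

section Cylinders

/-! ### Twists on cylinders -/

/-- An endomorphism of the unit acts on every object of a monoidal category. -/
def unitEndAct {C : Type*} [Category* C] [MonoidalCategory C] (A : C) (α : 𝟙_ C ⟶ 𝟙_ C) :
    A ⟶ A :=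
  (λ_ A).inv ≫ α ▷ A ≫ (λ_ A).hom

/-- Tensoring with an invertible object is an equivalence, hence fully faithful. No braiding is
assumed, so invertibility is required on both sides. -/
lemma bijective_unitEndAct {C : Type*} [Category* C] [MonoidalCategory C] {A B : C}
    (e : A ⊗ B ≅ 𝟙_ C) (e' : B ⊗ A ≅ 𝟙_ C) : Function.Bijective (unitEndAct A) := by
  let E : C ≌ C := CategoryTheory.Equivalence.mk (tensorRight A) (tensorRight B)
    ((rightUnitorNatIso C).symm ≪≫ (curriedTensor C).flip.mapIso e.symm ≪≫ tensorRightTensor A B)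
    ((tensorRightTensor B A).symm ≪≫ (curriedTensor C).flip.mapIso e' ≪≫ rightUnitorNatIso C)
  have h : Function.Bijective fun α : 𝟙_ C ⟶ 𝟙_ C => α ▷ A :=
    
    ⟨fun α β hαβ => E.functor.map_injective hαβ, fun β => E.functor.map_surjective β⟩
  exact ((λ_ A).homCongr (λ_ A)).bijective.comp h

/-- The unit endomorphism on the right is conjugated by the unit constraint, the same form as in
`autCls_pull`. -/
lemma map_unitEndAct {C D : Type*} [Category* C] [MonoidalCategory C] [Category* D]
    [MonoidalCategory D] (F : C ⥤ D) [F.Monoidal] (A : C) (α : 𝟙_ C ⟶ 𝟙_ C) :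
    F.map (unitEndAct A α) = unitEndAct (F.obj A)
      (Functor.LaxMonoidal.ε F ≫ F.map α ≫ Functor.OplaxMonoidal.η F) := by
  simp only [unitEndAct, Functor.map_comp, Functor.Monoidal.map_leftUnitor,
    Functor.Monoidal.map_leftUnitor_inv, Functor.Monoidal.map_whiskerRight, Category.assoc,
    Functor.Monoidal.μ_δ_assoc, comp_whiskerRight]

variable (M : TwistModel.{u, v, w} G)

/-- A twist of class `-[P]` is a tensor inverse of `P`, because classes add and detect isomorphism.
-/
lemma TwistModel.bijective_unitEndAct {X : GSpace G} (hX : M.Good X) (P : M.Tw X) :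
    Function.Bijective (unitEndAct P) := by
  obtain ⟨Q, hQ⟩ := M.cls_surjective hX (-M.cls P)
  obtain ⟨e⟩ := (M.cls_eq_iff (P ⊗ Q) (𝟙_ _) hX).1 (by
    rw [M.cls_tensor P Q hX, M.cls_unit hX, hQ, add_neg_cancel])
  obtain ⟨e'⟩ := (M.cls_eq_iff (Q ⊗ P) (𝟙_ _) hX).1 (by
    rw [M.cls_tensor Q P hX, M.cls_unit hX, hQ, neg_add_cancel])
  exact TDuality.bijective_unitEndAct e e'

variable [IsTopologicalGroup G]

/-- `unitEndAct` intertwines restriction of endomorphisms of `A` with restriction of endomorphisms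
of the unit, which is the isomorphism on `H²_G`. -/
lemma TwistModel.bijective_map_pull_cylι {Z : GSpace G} (hZ : M.Good Z) (A : M.Tw Z.cyl) :
    Function.Bijective fun α : A ⟶ A => (M.pull (Z.cylι 0)).map α := by
  have hC := M.good_cyl Z hZ
  let F := M.pull (Z.cylι 0)
  let f : (𝟙_ (M.Tw Z.cyl) ⟶ 𝟙_ _) → (𝟙_ (M.Tw Z) ⟶ 𝟙_ _) := fun α =>
    Functor.LaxMonoidal.ε F ≫ F.map α ≫ Functor.OplaxMonoidal.η F
  have hf : Function.Bijective f := by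
    have h : ((M.autCls hZ) ∘ (Groupoid.isoEquivHom _ _).symm) ∘ f =
        ((borelCohomology 2).map (Z.cylι 0).op) ∘
          ((M.autCls hC) ∘ (Groupoid.isoEquivHom _ _).symm) := by
      funext α
      refine Eq.trans (congrArg (M.autCls hZ) ?_)
        (M.autCls_pull (Z.cylι 0) hZ hC ((Groupoid.isoEquivHom _ _).symm α))
      exact Iso.ext rfl
    refine (Function.Bijective.of_comp_iff' ((M.autCls hZ).bijective.comp
      (Groupoid.isoEquivHom _ _).symm.bijective) f).1 ?_
    rw [h]
    exact (bijective_borelCohomology_map_cylι Z 2).comp ((M.autCls hC).bijective.comp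
      (Groupoid.isoEquivHom _ _).symm.bijective)
  have h : (fun α : A ⟶ A => F.map α) ∘ unitEndAct A = unitEndAct (F.obj A) ∘ f :=
    funext fun α => map_unitEndAct F A α
  refine (Function.Bijective.of_comp_iff _ (M.bijective_unitEndAct hC A)).1 ?_
  rw [h]
  exact (M.bijective_unitEndAct hZ _).comp hf

/-- Restriction is injective on `H³_G`. The isomorphism obtained need not restrict to `e`; it only
provides a base point. -/
lemma TwistModel.nonempty_iso_of_pull_cylι {Z : GSpace G} (hZ : M.Good Z) (A B : M.Tw Z.cyl)
    (e : (M.pull (Z.cylι 0)).obj A ≅ (M.pull (Z.cylι 0)).obj B) : Nonempty (A ≅ B) := by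
  have hC := M.good_cyl Z hZ
  rw [← M.cls_eq_iff A B hC]
  apply (bijective_borelCohomology_map_cylι Z 3).1
  rw [← M.cls_pull (Z.cylι 0) A hZ hC, ← M.cls_pull (Z.cylι 0) B hZ hC, M.cls_eq_iff _ _ hZ]
  exact ⟨e⟩

/-- An isomorphism over `Z × {0}` extends uniquely to `Z × [0,1]`. -/
lemma TwistModel.bijective_map_pull_cylι' {Z : GSpace G} (hZ : M.Good Z) (A B : M.Tw Z.cyl) :
    Function.Bijective fun α : A ⟶ B => (M.pull (Z.cylι 0)).map α := by
  let F := M.pull (Z.cylι 0)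
  -- A base point `e` identifies morphisms `A ⟶ B` with endomorphisms of `A`, compatibly with
  -- restriction.
  have h (e : A ⟶ B) : Function.Bijective fun α : A ⟶ B => F.map α := by
    have h1 : (fun α : A ⟶ B => F.map α) =
        (fun β => β ≫ F.map e) ∘ (fun α : A ⟶ A => F.map α) ∘ fun α : A ⟶ B => α ≫ inv e := by
      funext α
      simp
    rw [h1]
    exact ((asIso (F.map e)).homToEquiv.bijective).comp ((M.bijective_map_pull_cylι hZ A).comp
      (asIso (inv e)).homToEquiv.bijective)
  -- For injectivity one of the two given morphisms is the base point; for surjectivity it comes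
  -- from `H³_G`.
  refine ⟨fun α β hαβ => (h α).1 hαβ, fun β => ?_⟩
  obtain ⟨e⟩ := M.nonempty_iso_of_pull_cylι hZ A B (asIso β)
  exact (h e.hom).2 β

end Cylinders

section TwistedSpaces

/-! ### The category of spaces with a twist -/

variable {M : TwistModel.{u, v, w} G}

variable (M) in
/-- A `G`-space with a twist on it. -/
structure TwistedSpace where
  space : GSpace G
  tw : M.Tw space

namespace TwistedSpace

/-- A morphism `(X, P) ⟶ (Y, Q)` is a map `f : X ⟶ Y` with an isomorphism `P ≅ f^*Q`. -/
structure Hom (A B : TwistedSpace M) where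
  base : A.space ⟶ B.space
  iso : A.tw ⟶ (M.pull base).obj B.tw

lemma Hom.ext' {A B : TwistedSpace M} {a b : Hom A B} (h : a.base = b.base)
    (h' : a.iso ≫ eqToHom (by rw [h]) = b.iso) : a = b := by
  obtain ⟨f, φ⟩ := a
  obtain ⟨g, ψ⟩ := b
  obtain rfl : f = g := h
  simp only [eqToHom_refl, Category.comp_id] at h'
  rw [h']

/-- Composition of twisted maps uses the inverse coherence isomorphisms, so the coherence axioms are
needed inverted: this and the next two lemmas yield the unit laws and associativity. -/
lemma pullId_inv_pullComp_inv {X Y : GSpace G} (f : X ⟶ Y) (P : M.Tw Y) :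
    (M.pullId X).inv.app ((M.pull f).obj P) ≫ (M.pullComp (𝟙 X) f).inv.app P =
      eqToHom (by rw [Category.id_comp]; rfl) := by
  rw [← cancel_mono ((M.pullComp (𝟙 X) f).hom.app P), Category.assoc, Iso.inv_hom_id_app,
    ← cancel_mono ((M.pullId X).hom.app ((M.pull f).obj P)), Category.assoc, Category.assoc,
    M.pull_id_comp f P]
  simp

lemma pull_map_pullId_inv_pullComp_inv {X Y : GSpace G} (f : X ⟶ Y) (P : M.Tw Y) :
    (M.pull f).map ((M.pullId Y).inv.app P) ≫ (M.pullComp f (𝟙 Y)).inv.app P =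
      eqToHom (by rw [Category.comp_id]; rfl) := by
  rw [← cancel_mono ((M.pullComp f (𝟙 Y)).hom.app P), Category.assoc, Iso.inv_hom_id_app,
    ← cancel_mono ((M.pull f).map ((M.pullId Y).hom.app P)), Category.assoc, Category.assoc,
    M.pull_comp_id f P]
  simp [← Functor.map_comp]

lemma pullComp_inv_assoc {W X Y Z : GSpace G} (f : W ⟶ X) (g : X ⟶ Y) (h : Y ⟶ Z) (P : M.Tw Z) :
    (M.pullComp f g).inv.app ((M.pull h).obj P) ≫ (M.pullComp (f ≫ g) h).inv.app P ≫
      eqToHom (by rw [Category.assoc]) =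
      (M.pull f).map ((M.pullComp g h).inv.app P) ≫ (M.pullComp f (g ≫ h)).inv.app P := by
  rw [← cancel_mono ((M.pullComp f (g ≫ h)).hom.app P ≫
    (M.pull f).map ((M.pullComp g h).hom.app P))]
  simp only [Category.assoc]
  rw [← M.pull_assoc f g h P]
  simp [← Functor.map_comp]

/-- This is the Grothendieck construction of the pullback pseudofunctor. Diagrams of pullback
isomorphisms become equations between composites. -/
instance : Category (TwistedSpace M) where
  Hom := Hom
  id A := ⟨𝟙 _, (M.pullId _).inv.app A.tw⟩
  comp {A B C} a b := ⟨a.base ≫ b.base,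
    a.iso ≫ (M.pull a.base).map b.iso ≫ (M.pullComp a.base b.base).inv.app C.tw⟩
  id_comp {A B} a := by
    refine Hom.ext' (Category.id_comp a.base) ?_
    have h := (M.pullId A.space).inv.naturality a.iso
    dsimp only [Functor.id_map] at h ⊢
    rw [← Category.assoc ((M.pullId A.space).inv.app A.tw), ← h, Category.assoc, Category.assoc,
      ← Category.assoc ((M.pullId A.space).inv.app _), pullId_inv_pullComp_inv]
    simp
  comp_id {A B} a := by
    refine Hom.ext' (Category.comp_id a.base) ?_
    dsimp only
    rw [pull_map_pullId_inv_pullComp_inv]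
    simp
  assoc {A B C D} a b c := by
    refine Hom.ext' (Category.assoc a.base b.base c.base) ?_
    simp only [Functor.map_comp, Category.assoc]
    rw [← pullComp_inv_assoc, ← (M.pullComp a.base b.base).inv.naturality_assoc c.iso]
    rfl

lemma comp_base {A B C : TwistedSpace M} (a : A ⟶ B) (b : B ⟶ C) :
    (a ≫ b).base = a.base ≫ b.base := rfl

lemma comp_iso {A B C : TwistedSpace M} (a : A ⟶ B) (b : B ⟶ C) :
    (a ≫ b).iso = a.iso ≫ (M.pull a.base).map b.iso ≫
      (M.pullComp a.base b.base).inv.app C.tw := rfl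

/-- Every morphism is cartesian. -/
lemma exists_lift {A B C : TwistedSpace M} (b : B ⟶ C) (k : A ⟶ C) (f : A.space ⟶ B.space)
    (h : f ≫ b.base = k.base) : ∃ a : A ⟶ B, a.base = f ∧ a ≫ b = k := by
  refine ⟨⟨f, k.iso ≫ eqToHom (by rw [h]) ≫ (M.pullComp f b.base).hom.app C.tw ≫
    (M.pull f).map (inv b.iso)⟩, rfl, Hom.ext' h ?_⟩
  simp [comp_iso]

/-- The uniqueness half of the cartesian property: the isomorphism component of `b` can be
cancelled. -/
lemma hom_ext {A B C : TwistedSpace M} (b : B ⟶ C) {a a' : A ⟶ B} (h : a.base = a'.base)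
    (h' : a ≫ b = a' ≫ b) : a = a' := by
  obtain ⟨f, φ⟩ := a
  obtain ⟨g, ψ⟩ := a'
  obtain rfl : f = g := h
  have h'' : φ ≫ (M.pull f).map b.iso ≫ (M.pullComp f b.base).inv.app C.tw =
      ψ ≫ (M.pull f).map b.iso ≫ (M.pullComp f b.base).inv.app C.tw := by
    injection h'
  rw [cancel_mono] at h''
  rw [h'']

/-- The isomorphism `θ`, as a morphism over the identity. -/
def vert {X : GSpace G} {P Q : M.Tw X} (θ : P ⟶ Q) : mk X P ⟶ mk X Q :=
  ⟨𝟙 X, θ ≫ (M.pullId X).inv.app Q⟩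

/-- The projection `(X, f^*Q) ⟶ (Y, Q)`. -/
def cart {X Y : GSpace G} (f : X ⟶ Y) (Q : M.Tw Y) : mk X ((M.pull f).obj Q) ⟶ mk Y Q :=
  ⟨f, 𝟙 _⟩

end TwistedSpace

/-! ### Calculus of vertical and cartesian morphisms -/

namespace TwistedSpace

lemma vert_comp_mk {X Y : GSpace G} {P P' : M.Tw X} {Q : M.Tw Y} (θ : P ⟶ P') (f : X ⟶ Y)
    (φ : P' ⟶ (M.pull f).obj Q) :
    vert θ ≫ (⟨f, φ⟩ : mk X P' ⟶ mk Y Q) = (⟨f, θ ≫ φ⟩ : mk X P ⟶ mk Y Q) := by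
  refine Hom.ext' (Category.id_comp f) ?_
  have h := (M.pullId X).inv.naturality φ
  dsimp only [Functor.id_map, comp_iso, vert] at h ⊢
  simp only [Category.assoc]
  rw [← Category.assoc ((M.pullId X).inv.app P'), ← h, Category.assoc,
    ← Category.assoc ((M.pullId X).inv.app _), pullId_inv_pullComp_inv]
  simp

lemma mk_comp_vert {X Y : GSpace G} {P : M.Tw X} {Q Q' : M.Tw Y} (f : X ⟶ Y)
    (φ : P ⟶ (M.pull f).obj Q) (θ : Q ⟶ Q') :
    (⟨f, φ⟩ : mk X P ⟶ mk Y Q) ≫ vert θ =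
      (⟨f, φ ≫ (M.pull f).map θ⟩ : mk X P ⟶ mk Y Q') := by
  refine Hom.ext' (Category.comp_id f) ?_
  dsimp only [comp_iso, vert]
  simp only [Functor.map_comp, Category.assoc]
  rw [← Category.assoc ((M.pull f).map ((M.pullId Y).inv.app Q')),
    pull_map_pullId_inv_pullComp_inv]
  simp

lemma vert_comp_cart {X Y : GSpace G} {P : M.Tw X} {Q : M.Tw Y} (f : X ⟶ Y)
    (φ : P ⟶ (M.pull f).obj Q) :
    vert φ ≫ cart f Q = (⟨f, φ⟩ : mk X P ⟶ mk Y Q) := by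
  rw [cart, vert_comp_mk, Category.comp_id]

lemma vert_id {X : GSpace G} (P : M.Tw X) : vert (𝟙 P) = 𝟙 (mk X P) := by
  rw [vert, Category.id_comp]
  rfl

lemma vert_comp {X : GSpace G} {P Q R : M.Tw X} (θ : P ⟶ Q) (η : Q ⟶ R) :
    vert (θ ≫ η) = vert θ ≫ vert η := by
  refine Eq.symm ((vert_comp_mk θ (𝟙 X) _).trans ?_)
  rw [vert, Category.assoc]

lemma vert_injective {X : GSpace G} {P Q : M.Tw X} :
    Function.Injective (vert : (P ⟶ Q) → (mk X P ⟶ mk X Q)) := by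
  intro θ η h
  have h' : θ ≫ (M.pullId X).inv.app Q = η ≫ (M.pullId X).inv.app Q := by injection h
  rwa [cancel_mono] at h'

lemma vert_inv_hom {X : GSpace G} {P Q : M.Tw X} (θ : P ≅ Q) :
    vert θ.inv ≫ vert θ.hom = 𝟙 _ := by
  rw [← vert_comp, Iso.inv_hom_id, vert_id]

lemma vert_hom_inv {X : GSpace G} {P Q : M.Tw X} (θ : P ≅ Q) :
    vert θ.hom ≫ vert θ.inv = 𝟙 _ := by
  rw [← vert_comp, Iso.hom_inv_id, vert_id]

lemma vert_map_comp_cart {X Y : GSpace G} (f : X ⟶ Y) {P Q : M.Tw Y} (θ : P ⟶ Q) :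
    vert ((M.pull f).map θ) ≫ cart f Q = cart f P ≫ vert θ := by
  rw [vert_comp_cart, cart, mk_comp_vert, Category.id_comp]

lemma vert_pullComp_comp_cart {X Y Z : GSpace G} (f : X ⟶ Y) (g : Y ⟶ Z) (P : M.Tw Z) :
    vert ((M.pullComp f g).hom.app P) ≫ cart f _ ≫ cart g P = cart (f ≫ g) P := by
  have h : cart f _ ≫ cart g P =
      (⟨f ≫ g, (M.pullComp f g).inv.app P⟩ : mk X _ ⟶ mk Z P) := by
    refine Hom.ext' rfl ?_
    simp [cart, comp_iso]
  rw [h, vert_comp_mk, Iso.hom_inv_id_app]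
  rfl

lemma vert_pullTri_comp_cart {A B C : GSpace G} {f : A ⟶ B} {g : B ⟶ C} {h : A ⟶ C}
    (e : f ≫ g = h) (P : M.Tw C) :
    vert (M.pullTri e P).hom ≫ cart f _ ≫ cart g P = cart h P := by
  subst e
  rw [← vert_pullComp_comp_cart]
  simp [TwistModel.pullTri]

lemma vert_pullId (X : GSpace G) (P : M.Tw X) : vert ((M.pullId X).hom.app P) = cart (𝟙 X) P := by
  refine Hom.ext' rfl ?_
  simp [vert, cart]

/-- The inclusion `(Z, R) ⟶ (Z × [0,1], pr^*R)` at height `s`. -/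
def cylIncl {Z : GSpace G} (R : M.Tw Z) (s : unitInterval) :
    mk Z R ⟶ mk Z.cyl ((M.pull Z.cylProj).obj R) :=
  vert ((M.pullId Z).inv.app R ≫ (M.pullTri (Z.cylι_proj s) R).hom) ≫ cart (Z.cylι s) _

/-- Together with its base map this equation determines `cylIncl`, by `hom_ext`. -/
lemma cylIncl_comp_cart {Z : GSpace G} (R : M.Tw Z) (s : unitInterval) :
    cylIncl R s ≫ cart Z.cylProj R = 𝟙 _ := by
  rw [cylIncl, Category.assoc, vert_comp, Category.assoc, vert_pullTri_comp_cart, ← vert_pullId,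
    ← vert_comp, Iso.inv_hom_id_app]
  exact vert_id R

lemma vert_slice_comp {Z A S : GSpace G} {R : M.Tw Z} {T : M.Tw S} {c : Z.cyl ⟶ S}
    (Θ : (M.pull Z.cylProj).obj R ≅ (M.pull c).obj T) (s : unitInterval)
    {q : Z ⟶ A} {i : A ⟶ S} (h : Z.cylι s ≫ c = q ≫ i) :
    vert (slice Θ s h).hom ≫ cart q _ ≫ cart i T = cylIncl R s ≫ vert Θ.hom ≫ cart c T := by
  have h1 : vert (M.pullTri h T).inv ≫ cart (q ≫ i) T = cart (Z.cylι s) _ ≫ cart c T := by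
    rw [← vert_pullTri_comp_cart h, ← Category.assoc, vert_inv_hom, Category.id_comp]
  simp only [slice, Iso.trans_hom, Iso.symm_hom, Functor.mapIso_hom, Iso.app_hom, Iso.app_inv,
    vert_comp, Category.assoc]
  rw [vert_pullComp_comp_cart, h1, ← Category.assoc (vert ((M.pull _).map _)),
    vert_map_comp_cart, cylIncl, vert_comp]
  simp only [Category.assoc]

/-- This turns the coherence composites in `Induces` into commuting squares of twisted spaces. The
inverse of `r` appears because inclusions run from `P` to `T`. -/
lemma slice_eq_iff {Z A S : GSpace G} {R : M.Tw Z} {T : M.Tw S} {c : Z.cyl ⟶ S}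
    (Θ : (M.pull Z.cylProj).obj R ≅ (M.pull c).obj T) (s : unitInterval)
    {q : Z ⟶ A} {i : A ⟶ S} (h : Z.cylι s ≫ c = q ≫ i) {P : M.Tw A}
    (r : (M.pull i).obj T ≅ P) (u : R ≅ (M.pull q).obj P) :
    slice Θ s h ≪≫ (M.pull q).mapIso r = u ↔
      cylIncl R s ≫ vert Θ.hom ≫ cart c T = vert u.hom ≫ cart q P ≫ vert r.inv ≫ cart i T := by
  rw [← vert_slice_comp Θ s h, ← Category.assoc (cart q P), ← vert_map_comp_cart]
  have h' : slice Θ s h ≪≫ (M.pull q).mapIso r = u ↔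
      (slice Θ s h).hom = u.hom ≫ (M.pull q).map r.inv := by
    rw [Iso.ext_iff, Iso.trans_hom, Functor.mapIso_hom, ← Functor.mapIso_inv, Iso.eq_comp_inv]
    rfl
  rw [h']
  constructor
  · intro h
    rw [h, vert_comp]
    simp only [Category.assoc]
  · intro h
    apply vert_injective
    refine hom_ext (a := vert _) (a' := vert _) (cart q _ ≫ cart i T) rfl ?_
    rw [h, vert_comp]
    simp only [Category.assoc]

/-! ### Unique homotopy lifting -/

section

variable [IsTopologicalGroup G]

/-- Homotopy lifting. -/
lemma exists_cyl_lift {Z : GSpace G} (hZ : M.Good Z) {R : M.Tw Z} {A : M.Tw Z.cyl}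
    {T : TwistedSpace M} (ι : mk Z R ⟶ mk Z.cyl A) (hι : ι.base = Z.cylι 0) (f : mk Z R ⟶ T)
    (c : Z.cyl ⟶ T.space) (h : Z.cylι 0 ≫ c = f.base) :
    ∃ Θ : mk Z.cyl A ⟶ T, Θ.base = c ∧ ι ≫ Θ = f := by
  obtain ⟨⟨b, γ⟩, hb, hg⟩ := exists_lift (cart c T.tw) f (Z.cylι 0) h
  obtain rfl : b = Z.cylι 0 := hb
  obtain ⟨i, ι⟩ := ι
  obtain rfl : i = Z.cylι 0 := hι
  -- Over `Z × {0}` the prescribed start `f` amounts to the morphism `inv ι ≫ γ` from `A` to `c^*T`;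
  -- extend it over the cylinder.
  obtain ⟨φ, hφ⟩ := (M.bijective_map_pull_cylι' hZ A ((M.pull c).obj T.tw)).2 (inv ι ≫ γ)
  refine ⟨vert φ ≫ cart c T.tw, Category.id_comp c, ?_⟩
  dsimp only at hφ
  rw [← Category.assoc, mk_comp_vert, hφ, IsIso.hom_inv_id_assoc]
  exact hg

/-- Uniqueness of homotopy lifts. -/
lemma cyl_ext {Z : GSpace G} (hZ : M.Good Z) {R : M.Tw Z} {A : M.Tw Z.cyl}
    {T : TwistedSpace M} (ι : mk Z R ⟶ mk Z.cyl A) (hι : ι.base = Z.cylι 0)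
    {Θ Θ' : mk Z.cyl A ⟶ T} (hb : Θ.base = Θ'.base) (h : ι ≫ Θ = ι ≫ Θ') : Θ = Θ' := by
  obtain ⟨c, φ⟩ := Θ
  obtain ⟨c', φ'⟩ := Θ'
  obtain rfl : c = c' := hb
  obtain ⟨i, ι⟩ := ι
  obtain rfl : i = Z.cylι 0 := hι
  have h1 : (⟨Z.cylι 0, ι⟩ : mk Z R ⟶ mk Z.cyl A) ≫ vert φ =
      (⟨Z.cylι 0, ι⟩ : mk Z R ⟶ mk Z.cyl A) ≫ vert φ' := by
    refine hom_ext (a := _ ≫ vert φ) (a' := _ ≫ vert φ') (cart c T.tw) rfl ?_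
    rw [Category.assoc, Category.assoc, vert_comp_cart, vert_comp_cart]
    exact h
  rw [mk_comp_vert, mk_comp_vert] at h1
  have h2 : ι ≫ (M.pull (Z.cylι 0)).map φ = ι ≫ (M.pull (Z.cylι 0)).map φ' := by injection h1
  rw [cancel_epi] at h2
  rw [(M.bijective_map_pull_cylι' hZ _ _).1 h2]

/-- Two lifts of a homotopy that agree at `0` agree at `1`. -/
lemma comp_eq_of_homotopy {Z : GSpace G} (hZ : M.Good Z) {R : M.Tw Z} {T : TwistedSpace M}
    {Θ Θ' : mk Z.cyl ((M.pull Z.cylProj).obj R) ⟶ T} (hb : Θ.base = Θ'.base)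
    (h : cylIncl R 0 ≫ Θ = cylIncl R 0 ≫ Θ') : cylIncl R 1 ≫ Θ = cylIncl R 1 ≫ Θ' := by
  rw [cyl_ext hZ (cylIncl R 0) rfl hb h]

end

/-! ### Gluing as commuting squares of twisted spaces -/

section Glue

variable {X : GSpace G} {U V : Set X} {hU : ∀ (g : G), ∀ x ∈ U, g • x ∈ U}
  {hV : ∀ (g : G), ∀ x ∈ V, g • x ∈ V} {hUV : ∀ (g : G), ∀ x ∈ U ∩ V, g • x ∈ U ∩ V}

/-- The transition isomorphism is presented as a span out of an auxiliary twist `R` on the overlap,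
so that gluing becomes commutativity of one square. -/
lemma glue_condition_iff {PU : M.Tw (X.sub U hU)} {PV : M.Tw (X.sub V hV)} {P : M.Tw X}
    (ψU : (M.pull (X.subι U hU)).obj P ≅ PU) (ψV : (M.pull (X.subι V hV)).obj P ≅ PV)
    (R : M.Tw (X.sub (U ∩ V) hUV))
    (α : R ⟶ (M.pull (X.incl hUV hU Set.inter_subset_left)).obj PU)
    (β : R ⟶ (M.pull (X.incl hUV hV Set.inter_subset_right)).obj PV) :
    (M.pullComp (X.incl hUV hU Set.inter_subset_left) (X.subι U hU)).hom.app P ≫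
          (M.pull (X.incl hUV hU Set.inter_subset_left)).map ψU.hom ≫ (inv α ≫ β) =
        (M.pullComp (X.incl hUV hV Set.inter_subset_right) (X.subι V hV)).hom.app P ≫
          (M.pull (X.incl hUV hV Set.inter_subset_right)).map ψV.hom ↔
      (⟨_, α⟩ : mk _ R ⟶ mk _ PU) ≫ vert ψU.inv ≫ cart (X.subι U hU) P =
        (⟨_, β⟩ : mk _ R ⟶ mk _ PV) ≫ vert ψV.inv ≫ cart (X.subι V hV) P := by
  let iU := X.incl hUV hU Set.inter_subset_left
  let iV := X.incl hUV hV Set.inter_subset_right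
  -- `Y` identifies the restriction of `P` to the overlap with `R`. It has a section `Y'`, so it may
  -- be cancelled, and it turns the `U`-leg into a plain cartesian projection.
  let Y : mk (X.sub (U ∩ V) hUV) ((M.pull (iU ≫ X.subι U hU)).obj P) ⟶ mk _ R :=
    vert ((M.pullComp iU (X.subι U hU)).hom.app P ≫ (M.pull iU).map ψU.hom ≫ inv α)
  let Y' : mk _ R ⟶ mk (X.sub (U ∩ V) hUV) ((M.pull (iU ≫ X.subι U hU)).obj P) :=
    vert (inv ((M.pullComp iU (X.subι U hU)).hom.app P ≫ (M.pull iU).map ψU.hom ≫ inv α))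
  have hY' : Y' ≫ Y = 𝟙 _ := by
    rw [← vert_comp, IsIso.inv_hom_id, vert_id]
  have h1 : Y ≫ (⟨iU, α⟩ : mk _ R ⟶ mk _ PU) ≫ vert ψU.inv ≫ cart (X.subι U hU) P =
      cart (iU ≫ X.subι U hU) P := by
    have hY : Y ≫ vert α = vert ((M.pullComp iU (X.subι U hU)).hom.app P) ≫
        vert ((M.pull iU).map ψU.hom) := by
      rw [← vert_comp, ← vert_comp, Category.assoc, Category.assoc, IsIso.inv_hom_id,
        Category.comp_id]
    rw [← vert_comp_cart, ← vert_pullComp_comp_cart, Category.assoc, ← Category.assoc Y, hY,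
      Category.assoc]
    rw [← Category.assoc (vert _) (cart iU PU), vert_map_comp_cart, Category.assoc,
      ← Category.assoc (vert _) (vert _), vert_hom_inv, Category.id_comp]
  have h2 : vert ((M.pullComp iV (X.subι V hV)).hom.app P ≫ (M.pull iV).map ψV.hom) ≫
      cart iV PV ≫ vert ψV.inv ≫ cart (X.subι V hV) P = cart (iV ≫ X.subι V hV) P := by
    rw [vert_comp, Category.assoc, ← Category.assoc (vert _) (cart iV PV), vert_map_comp_cart,
      Category.assoc, ← Category.assoc (vert _) (vert _), vert_hom_inv, Category.id_comp,
      vert_pullComp_comp_cart]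
  have h3 : Y ≫ (⟨iV, β⟩ : mk _ R ⟶ mk _ PV) = vert ((M.pullComp iU (X.subι U hU)).hom.app P ≫
      (M.pull iU).map ψU.hom ≫ inv α ≫ β) ≫ cart iV PV := by
    rw [← vert_comp_cart, ← Category.assoc, ← vert_comp]
    simp only [Category.assoc]
  constructor
  · intro h
    have h4 : Y ≫ (⟨iU, α⟩ : mk _ R ⟶ mk _ PU) ≫ vert ψU.inv ≫ cart (X.subι U hU) P =
        Y ≫ (⟨iV, β⟩ : mk _ R ⟶ mk _ PV) ≫ vert ψV.inv ≫ cart (X.subι V hV) P := by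
      rw [h1, ← Category.assoc Y, h3, h, Category.assoc]
      exact h2.symm
    have h5 := congrArg (fun a => Y' ≫ a) h4
    simpa only [← Category.assoc, hY', Category.id_comp] using h5
  · intro h
    apply vert_injective
    refine hom_ext (a := vert _) (a' := vert _)
      (cart iV PV ≫ vert ψV.inv ≫ cart (X.subι V hV) P) rfl ?_
    refine Eq.trans ?_ h2.symm
    rw [← Category.assoc, ← h3, Category.assoc, ← h]
    exact h1

/-- Twists can be glued. -/
lemma exists_glue (hX : M.Good X) (hUo : IsOpen U) (hVo : IsOpen V) (hcov : U ∪ V = Set.univ)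
    {PU : M.Tw (X.sub U hU)} {PV : M.Tw (X.sub V hV)} {R : M.Tw (X.sub (U ∩ V) hUV)}
    (α : mk _ R ⟶ mk _ PU) (β : mk _ R ⟶ mk _ PV)
    (hα : α.base = X.incl hUV hU Set.inter_subset_left)
    (hβ : β.base = X.incl hUV hV Set.inter_subset_right) :
    ∃ (P : M.Tw X) (ψU : mk _ PU ⟶ mk X P) (ψV : mk _ PV ⟶ mk X P),
      ψU.base = X.subι U hU ∧ ψV.base = X.subι V hV ∧ α ≫ ψU = β ≫ ψV := by
  obtain ⟨f, α⟩ := α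
  obtain rfl : f = _ := hα
  obtain ⟨f', β⟩ := β
  obtain rfl : f' = _ := hβ
  obtain ⟨P, ψU, ψV, h⟩ := M.glue X U V hU hV hUV hX hUo hVo hcov PU PV (asIso (inv α ≫ β))
  exact ⟨P, vert ψU.inv ≫ cart _ P, vert ψV.inv ≫ cart _ P, rfl, rfl,
    (glue_condition_iff ψU ψV R α β).1 h⟩

/-- The glued twist is unique up to isomorphism. -/
lemma exists_iso_of_glue (hX : M.Good X) (hUo : IsOpen U) (hVo : IsOpen V)
    (hcov : U ∪ V = Set.univ)
    {PU : M.Tw (X.sub U hU)} {PV : M.Tw (X.sub V hV)} {R : M.Tw (X.sub (U ∩ V) hUV)}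
    (α : mk _ R ⟶ mk _ PU) (β : mk _ R ⟶ mk _ PV)
    (hα : α.base = X.incl hUV hU Set.inter_subset_left)
    (hβ : β.base = X.incl hUV hV Set.inter_subset_right) {P P' : M.Tw X}
    {ψU : mk _ PU ⟶ mk X P} {ψV : mk _ PV ⟶ mk X P}
    {ψU' : mk _ PU ⟶ mk X P'} {ψV' : mk _ PV ⟶ mk X P'}
    (hψU : ψU.base = X.subι U hU) (hψV : ψV.base = X.subι V hV)
    (hψU' : ψU'.base = X.subι U hU) (hψV' : ψV'.base = X.subι V hV)
    (h : α ≫ ψU = β ≫ ψV) (h' : α ≫ ψU' = β ≫ ψV') :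
    ∃ θ : P ≅ P', ψU ≫ vert θ.hom = ψU' ∧ ψV ≫ vert θ.hom = ψV' := by
  obtain ⟨f, α⟩ := α
  obtain rfl : f = _ := hα
  obtain ⟨f', β⟩ := β
  obtain rfl : f' = _ := hβ
  obtain ⟨g1, a⟩ := ψU
  obtain rfl : g1 = _ := hψU
  obtain ⟨g2, b⟩ := ψV
  obtain rfl : g2 = _ := hψV
  obtain ⟨g3, a'⟩ := ψU'
  obtain rfl : g3 = _ := hψU'
  obtain ⟨g4, b'⟩ := ψV'
  obtain rfl : g4 = _ := hψV'
  have e1 : (⟨X.subι U hU, a⟩ : mk _ PU ⟶ mk X P) = vert (asIso a).symm.inv ≫ cart _ P :=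
    (vert_comp_cart _ _).symm
  have e2 : (⟨X.subι V hV, b⟩ : mk _ PV ⟶ mk X P) = vert (asIso b).symm.inv ≫ cart _ P :=
    (vert_comp_cart _ _).symm
  have e3 : (⟨X.subι U hU, a'⟩ : mk _ PU ⟶ mk X P') = vert (asIso a').symm.inv ≫ cart _ P' :=
    (vert_comp_cart _ _).symm
  have e4 : (⟨X.subι V hV, b'⟩ : mk _ PV ⟶ mk X P') = vert (asIso b').symm.inv ≫ cart _ P' :=
    (vert_comp_cart _ _).symm
  rw [e1, e2] at h
  rw [e3, e4] at h'
  obtain ⟨θ, hθ, hθ'⟩ := M.glue_unique X U V hU hV hUV hX hUo hVo hcov PU PV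
    (asIso (inv α ≫ β)) P P' _ _ _ _ ((glue_condition_iff _ _ R α β).2 h)
    ((glue_condition_iff _ _ R α β).2 h')
  refine ⟨θ, ?_, ?_⟩
  · rw [mk_comp_vert]
    refine congrArg (Hom.mk _) ?_
    simpa [← Iso.eq_comp_inv, Iso.eq_inv_comp] using hθ
  · rw [mk_comp_vert]
    refine congrArg (Hom.mk _) ?_
    simpa [← Iso.eq_comp_inv, Iso.eq_inv_comp] using hθ'

end Glue

end TwistedSpace

end TwistedSpaces

/-! ### Geometry of the sphere bundle -/

namespace CircleBundle

variable {X : GSpace G} (E F : CircleBundle X)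

lemma lineNorm_lmk (a : E.tot × ℂ) : E.lineNorm (E.lmk a) = ‖a.2‖ := rfl

lemma lineProj_lmk (a : E.tot × ℂ) : E.lineProj (E.lmk a) = E.proj.toFun a.1 := rfl

lemma lineNorm_nonneg (l : E.Line) : 0 ≤ E.lineNorm l := by
  obtain ⟨a, rfl⟩ := E.lmk_surjective l
  exact norm_nonneg a.2

lemma continuous_lineNorm : Continuous E.lineNorm := by
  rw [E.isOpenQuotientMap_lmk.isQuotientMap.continuous_iff]
  exact continuous_norm.comp continuous_snd

lemma lmk_circle_smul (z : Circle) (e : E.tot) (c : ℂ) : E.lmk (z • e, c) = E.lmk (e, z * c) :=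
  Quotient.sound (E.lineSetoid.symm ⟨z, rfl, rfl⟩)

/-- The circle element relating the two representatives fixes `c ≠ 0`, so it is `1`. -/
lemma lmk_left_injective {c : ℂ} (hc : c ≠ 0) {e e' : E.tot} (h : E.lmk (e, c) = E.lmk (e', c)) :
    e = e' := by
  obtain ⟨z, h1, h2⟩ := Quotient.exact h
  have hz : z = 1 := by
    apply Circle.ext
    have h3 : (z : ℂ) * c = 1 * c := by rw [one_mul]; exact h2.symm
    simpa using mul_right_cancel₀ hc h3
  rw [hz, one_smul] at h1
  exact h1.symm

lemma lmk_arg_smul (e : E.tot) (c : ℂ) :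
    E.lmk (Circle.exp c.arg • e, (‖c‖ : ℂ)) = E.lmk (e, c) := by
  rw [lmk_circle_smul, Circle.coe_exp, mul_comm, Complex.norm_mul_exp_arg_mul_I]

lemma exists_lmk_lineNorm (l : E.Line) : ∃ e, E.lmk (e, (E.lineNorm l : ℂ)) = l := by
  obtain ⟨⟨e, c⟩, rfl⟩ := E.lmk_surjective l
  exact ⟨_, E.lmk_arg_smul e c⟩

/-- The unit vector in the direction of `l ≠ 0`. -/
def unit (l : E.Line) : E.tot := (E.exists_lmk_lineNorm l).choose

lemma lmk_unit (l : E.Line) : E.lmk (E.unit l, (E.lineNorm l : ℂ)) = l :=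
  (E.exists_lmk_lineNorm l).choose_spec

lemma proj_unit (l : E.Line) : E.proj.toFun (E.unit l) = E.lineProj l := by
  conv_rhs => rw [← E.lmk_unit l]
  rfl

/-- Away from zero the representative with positive real coefficient is unique, so the choice in
`unit` is forced. -/
lemma unit_lmk_ofReal {r : ℝ} (hr : 0 < r) (e : E.tot) : E.unit (E.lmk (e, (r : ℂ))) = e := by
  have h := E.lmk_unit (E.lmk (e, (r : ℂ)))
  have h1 : E.lineNorm (E.lmk (e, (r : ℂ))) = r := by
    rw [lineNorm_lmk, Complex.norm_real, Real.norm_of_nonneg hr.le]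
  rw [h1] at h
  exact E.lmk_left_injective (Complex.ofReal_ne_zero.2 hr.ne') h

lemma unit_lmk {c : ℂ} (hc : c ≠ 0) (e : E.tot) :
    E.unit (E.lmk (e, c)) = Circle.exp c.arg • e := by
  rw [← lmk_arg_smul, unit_lmk_ofReal _ (norm_pos_iff.2 hc)]

lemma unit_smul (g : G) {l : E.Line} (hl : E.lineNorm l ≠ 0) : E.unit (g • l) = g • E.unit l := by
  apply E.lmk_left_injective (Complex.ofReal_ne_zero.2 hl)
  have h := E.lmk_unit (g • l)
  rw [lineNorm_smul] at h
  rw [h]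
  conv_lhs => rw [← E.lmk_unit l]
  rfl

/-- Continuity is tested upstairs along the open quotient map `lmk`, where `unit` has an explicit
formula near a nonzero vector. -/
lemma continuousAt_unit {l : E.Line} (hl : E.lineNorm l ≠ 0) : ContinuousAt E.unit l := by
  obtain ⟨⟨e, c⟩, rfl⟩ := E.lmk_surjective l
  rw [← E.isOpenQuotientMap_lmk.continuousAt_comp_iff]
  have hc : c ≠ 0 := norm_ne_zero_iff.1 hl
  have hev : ∀ᶠ a : E.tot × ℂ in 𝓝 (e, c), a.2 ≠ 0 :=
    continuousAt_snd.eventually_ne hc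
  -- `arg` jumps on the negative axis, but `exp (i arg d) = d / ‖d‖` does not.
  have h1 : ContinuousAt (fun d : ℂ => Circle.exp d.arg) c := by
    rw [(IsInducing.mk rfl : IsInducing fun z : Circle => (z : ℂ)).continuousAt_iff]
    have h2 : ContinuousAt (fun d : ℂ => d / ‖d‖) c :=
      continuousAt_id.div (by fun_prop) (by simpa using hc)
    refine h2.congr ?_
    filter_upwards [eventually_ne_nhds hc] with d hd
    have hd' : (‖d‖ : ℂ) ≠ 0 := by simpa using hd
    rw [Function.comp_apply, Circle.coe_exp, div_eq_iff hd', mul_comm,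
      Complex.norm_mul_exp_arg_mul_I]
  have h3 : ContinuousAt (fun a : E.tot × ℂ => Circle.exp a.2.arg • a.1) (e, c) :=
    (ContinuousAt.comp (x := (e, c)) (f := Prod.snd) h1 continuousAt_snd).smul continuousAt_fst
  refine h3.congr ?_
  filter_upwards [hev] with a ha
  exact (E.unit_lmk ha a.1).symm

/-- Multiplication by a real number on `E ×_{S¹} ℂ`. -/
def scale (t : ℝ) : E.Line → E.Line :=
  Quotient.map' (s₁ := E.lineSetoid) (s₂ := E.lineSetoid) (fun a => (a.1, t * a.2)) (by
    rintro a b ⟨z, h1, h2⟩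
    exact ⟨z, h1, by simp only [h2]; ring⟩)

lemma scale_lmk (t : ℝ) (a : E.tot × ℂ) : E.scale t (E.lmk a) = E.lmk (a.1, t * a.2) := rfl

lemma scale_one (l : E.Line) : E.scale 1 l = l := by
  obtain ⟨a, rfl⟩ := E.lmk_surjective l
  simp [scale_lmk]

lemma scale_zero (l : E.Line) : E.scale 0 l = E.zero (E.lineProj l) := by
  obtain ⟨a, rfl⟩ := E.lmk_surjective l
  simp [scale_lmk, lineProj_lmk, zero_proj]

lemma scale_zero_section (t : ℝ) (x : X) : E.scale t (E.zero x) = E.zero x := by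
  obtain ⟨e, rfl⟩ := E.proj_surjective x
  simp [scale_lmk, zero_proj]

lemma lineProj_scale (t : ℝ) (l : E.Line) : E.lineProj (E.scale t l) = E.lineProj l := by
  obtain ⟨a, rfl⟩ := E.lmk_surjective l
  rfl

lemma lineNorm_scale (t : ℝ) (l : E.Line) : E.lineNorm (E.scale t l) = |t| * E.lineNorm l := by
  obtain ⟨a, rfl⟩ := E.lmk_surjective l
  simp [scale_lmk, lineNorm_lmk]

lemma scale_smul (t : ℝ) (g : G) (l : E.Line) : E.scale t (g • l) = g • E.scale t l := by
  obtain ⟨a, rfl⟩ := E.lmk_surjective l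
  rfl

lemma continuous_scale : Continuous fun a : ℝ × E.Line => E.scale a.1 a.2 := by
  have hq := (IsOpenQuotientMap.id (X := ℝ)).prodMap E.isOpenQuotientMap_lmk
  rw [hq.isQuotientMap.continuous_iff]
  change Continuous fun x : ℝ × (E.tot × ℂ) => E.lmk (x.2.1, x.1 * x.2.2)
  exact E.continuous_lmk.comp (by fun_prop)

/-! ### The two open charts of the sphere bundle and their retractions -/

variable {E F}

/-- The component in `E ×_{S¹} ℂ` of a point of the sphere bundle. -/
def compl (x : sphere E F) : E.Line := x.1.1

/-- The component in `F ×_{S¹} ℂ` of a point of the sphere bundle. -/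
def compr (x : sphere E F) : F.Line := x.1.2

lemma sphere_ext {x y : sphere E F} (h1 : compl x = compl y) (h2 : compr x = compr y) : x = y :=
  Subtype.ext (Prod.ext h1 h2)

lemma continuous_compl : Continuous (compl (E := E) (F := F)) :=
  continuous_fst.comp continuous_subtype_val

lemma continuous_compr : Continuous (compr (E := E) (F := F)) :=
  continuous_snd.comp continuous_subtype_val

lemma compl_smul (g : G) (x : sphere E F) : compl (g • x) = g • compl x := rfl

lemma compr_smul (g : G) (x : sphere E F) : compr (g • x) = g • compr x := rfl

lemma lineProj_comp (x : sphere E F) : E.lineProj (compl x) = F.lineProj (compr x) := x.2.1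

lemma lineNorm_comp (x : sphere E F) :
    E.lineNorm (compl x) ^ 2 + F.lineNorm (compr x) ^ 2 = 1 := x.2.2

variable (E F)

/-- The complement of `F` in the sphere bundle. -/
def chartL : Set (sphere E F) := {x | E.lineNorm (compl x) ≠ 0}

/-- The complement of `E` in the sphere bundle. -/
def chartR : Set (sphere E F) := {x | F.lineNorm (compr x) ≠ 0}

lemma smul_mem_chartL (g : G) : ∀ x ∈ chartL E F, g • x ∈ chartL E F := by
  intro x hx
  change E.lineNorm (compl (g • x)) ≠ 0
  rw [compl_smul, lineNorm_smul]
  exact hx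

lemma smul_mem_chartR (g : G) : ∀ x ∈ chartR E F, g • x ∈ chartR E F := by
  intro x hx
  change F.lineNorm (compr (g • x)) ≠ 0
  rw [compr_smul, lineNorm_smul]
  exact hx

lemma smul_mem_chartLR (g : G) :
    ∀ x ∈ chartL E F ∩ chartR E F, g • x ∈ chartL E F ∩ chartR E F :=
  fun x hx => ⟨smul_mem_chartL E F g x hx.1, smul_mem_chartR E F g x hx.2⟩

lemma isOpen_chartL : IsOpen (chartL E F) :=
  isOpen_ne_fun (E.continuous_lineNorm.comp continuous_compl) continuous_const

lemma isOpen_chartR : IsOpen (chartR E F) :=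
  isOpen_ne_fun (F.continuous_lineNorm.comp continuous_compr) continuous_const

lemma chartL_union_chartR : chartL E F ∪ chartR E F = Set.univ := by
  refine Set.eq_univ_of_forall fun x => ?_
  by_contra h
  have h' : E.lineNorm (compl x) = 0 ∧ F.lineNorm (compr x) = 0 := by
    simpa [chartL, chartR] using h
  have := lineNorm_comp x
  rw [h'.1, h'.2] at this
  norm_num at this

/-- The complement of `F` in the sphere bundle, as a `G`-space. -/
def spaceL : GSpace G := (sphere E F).sub (chartL E F) (smul_mem_chartL E F)

/-- The complement of `E` in the sphere bundle, as a `G`-space. -/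
def spaceR : GSpace G := (sphere E F).sub (chartR E F) (smul_mem_chartR E F)

/-- The complement of `E` and `F` in the sphere bundle, as a `G`-space. -/
def spaceLR : GSpace G := (sphere E F).sub (chartL E F ∩ chartR E F) (smul_mem_chartLR E F)

/-- The inclusion of the complement of `F`. -/
def ιL : spaceL E F ⟶ sphere E F := (sphere E F).subι _ _

/-- The inclusion of the complement of `E`. -/
def ιR : spaceR E F ⟶ sphere E F := (sphere E F).subι _ _

/-- The inclusion of the complement of `E` and `F` in the complement of `F`. -/
def jL : spaceLR E F ⟶ spaceL E F := (sphere E F).incl _ _ Set.inter_subset_left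

/-- The inclusion of the complement of `E` and `F` in the complement of `E`. -/
def jR : spaceLR E F ⟶ spaceR E F := (sphere E F).incl _ _ Set.inter_subset_right

lemma spaceL_hom_ext {Y : GSpace G} {f f' : Y ⟶ spaceL E F} (h : f ≫ ιL E F = f' ≫ ιL E F) :
    f = f' :=
  GMap.ext (funext fun y => Subtype.ext (congrFun (congrArg GMap.toFun h) y))

lemma spaceR_hom_ext {Y : GSpace G} {f f' : Y ⟶ spaceR E F} (h : f ≫ ιR E F = f' ≫ ιR E F) :
    f = f' :=
  GMap.ext (funext fun y => Subtype.ext (congrFun (congrArg GMap.toFun h) y))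

/-- The retraction onto `E` of the complement of `F`. -/
def retrL : spaceL E F ⟶ E.tot :=
  GMap.mk (X := spaceL E F) (fun x => E.unit (compl x.1))
    (continuous_iff_continuousAt.2 fun x => ContinuousAt.comp (x := x)
      (f := fun x : spaceL E F => compl x.1) (E.continuousAt_unit x.2)
      (continuous_compl.comp continuous_subtype_val).continuousAt)
    (fun g x => E.unit_smul g x.2)

/-- The retraction onto `F` of the complement of `E`. -/
def retrR : spaceR E F ⟶ F.tot :=
  GMap.mk (X := spaceR E F) (fun x => F.unit (compr x.1))
    (continuous_iff_continuousAt.2 fun x => ContinuousAt.comp (x := x)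
      (f := fun x : spaceR E F => compr x.1) (F.continuousAt_unit x.2)
      (continuous_compr.comp continuous_subtype_val).continuousAt)
    (fun g x => F.unit_smul g x.2)

lemma inl_mem (e : E.tot) : (inl E F).toFun e ∈ chartL E F := by
  change ‖(1 : ℂ)‖ ≠ 0
  simp

lemma inr_mem (e : F.tot) : (inr E F).toFun e ∈ chartR E F := by
  change ‖(1 : ℂ)‖ ≠ 0
  simp

/-- The inclusion of `E` in the complement of `F`. -/
def inclL : E.tot ⟶ spaceL E F :=
  GMap.mk (Y := spaceL E F) (fun e => ⟨(inl E F).toFun e, inl_mem E F e⟩)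
    ((inl E F).continuous'.subtype_mk _) (fun g e => Subtype.ext ((inl E F).map_smul' g e))

/-- The inclusion of `F` in the complement of `E`. -/
def inclR : F.tot ⟶ spaceR E F :=
  GMap.mk (Y := spaceR E F) (fun e => ⟨(inr E F).toFun e, inr_mem E F e⟩)
    ((inr E F).continuous'.subtype_mk _) (fun g e => Subtype.ext ((inr E F).map_smul' g e))

lemma inclL_retrL : inclL E F ≫ retrL E F = 𝟙 _ :=
  GMap.ext (funext fun e => by
    have h := E.unit_lmk_ofReal one_pos e
    rw [Complex.ofReal_one] at h
    exact h)

lemma inclR_retrR : inclR E F ≫ retrR E F = 𝟙 _ :=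
  GMap.ext (funext fun e => by
    have h := F.unit_lmk_ofReal one_pos e
    rw [Complex.ofReal_one] at h
    exact h)

end CircleBundle

/-- The map `f × [0,1]`. -/
def GSpace.cylMap {X Y : GSpace G} (f : X ⟶ Y) : X.cyl ⟶ Y.cyl :=
  GMap.mk (X := X.cyl) (Y := Y.cyl) (fun a : X × unitInterval => (f.toFun a.1, a.2))
    ((f.continuous'.comp continuous_fst).prodMk continuous_snd)
    (fun g a => Prod.ext (f.map_smul' g a.1) rfl)

/-- The height of a point of `X × [0,1]`. -/
def GSpace.height {X : GSpace G} (a : X.cyl) : unitInterval := a.2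

lemma GSpace.continuous_height {X : GSpace G} : Continuous (GSpace.height (X := X)) :=
  continuous_snd

/-- A map to `X × [0,1]` given by its components. -/
def GSpace.toCyl {Y X : GSpace G} (f : Y ⟶ X) (s : Y → unitInterval) (hs : Continuous s)
    (hs' : ∀ (g : G) y, s (g • y) = s y) : Y ⟶ X.cyl :=
  GMap.mk (Y := X.cyl) (fun y => (f.toFun y, s y)) (f.continuous'.prodMk hs)
    (fun g y => Prod.ext (f.map_smul' g y) (hs' g y))

/-! ### Deformation of the charts onto the two circle bundles -/

namespace CircleBundle

variable {X : GSpace G} (E F : CircleBundle X)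

/-- Positivity of this radicand does two things for `contractL`: the square root gives a point of
unit norm, and that point stays in the chart. -/
lemma contract_pos {x : sphere E F} {t : ℝ} (hx : E.lineNorm (compl x) ≠ 0) (ht : |t| ≤ 1) :
    0 < 1 - (|t| * F.lineNorm (compr x)) ^ 2 := by
  have h := lineNorm_comp x
  have h1 : 0 < E.lineNorm (compl x) ^ 2 := by positivity
  have h2 : (|t| * F.lineNorm (compr x)) ^ 2 ≤ F.lineNorm (compr x) ^ 2 := by
    rw [mul_pow]
    exact mul_le_of_le_one_left (sq_nonneg _) (pow_le_one₀ (abs_nonneg t) ht)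
  linarith

lemma contract_pos' {x : sphere E F} {t : ℝ} (hx : F.lineNorm (compr x) ≠ 0) (ht : |t| ≤ 1) :
    0 < 1 - (|t| * E.lineNorm (compl x)) ^ 2 := by
  have h := lineNorm_comp x
  have h1 : 0 < F.lineNorm (compr x) ^ 2 := by positivity
  have h2 : (|t| * E.lineNorm (compl x)) ^ 2 ≤ E.lineNorm (compl x) ^ 2 := by
    rw [mul_pow]
    exact mul_le_of_le_one_left (sq_nonneg _) (pow_le_one₀ (abs_nonneg t) ht)
  linarith

lemma abs_unitInterval_le (t : unitInterval) : |(t : ℝ)| ≤ 1 := by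
  rw [abs_of_nonneg t.2.1]
  exact t.2.2

lemma norm_ofReal_sqrt_sq {r : ℝ} (hr : 0 < r) : ‖((√r : ℝ) : ℂ)‖ ^ 2 = r := by
  rw [Complex.norm_real, Real.norm_of_nonneg (Real.sqrt_nonneg r), Real.sq_sqrt hr.le]

lemma norm_ofReal_sqrt_ne_zero {r : ℝ} (hr : 0 < r) : ‖((√r : ℝ) : ℂ)‖ ≠ 0 := by
  rw [norm_ne_zero_iff, Complex.ofReal_ne_zero]
  exact (Real.sqrt_pos.2 hr).ne'

/-- The contraction onto `E` of the complement of `F`. -/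
def contractL : (spaceL E F).cyl ⟶ spaceL E F :=
  GMap.mk (X := (spaceL E F).cyl) (Y := spaceL E F)
    (fun a : spaceL E F × unitInterval =>
      ⟨⟨(E.lmk ((retrL E F).toFun a.1,
            ((√(1 - (|(a.2 : ℝ)| * F.lineNorm (compr a.1.1)) ^ 2) : ℝ) : ℂ)),
          F.scale a.2 (compr a.1.1)), by
        refine ⟨?_, ?_⟩
        · rw [lineProj_scale, ← lineProj_comp]
          exact E.proj_unit _
        · rw [lineNorm_scale, lineNorm_lmk,
            norm_ofReal_sqrt_sq (contract_pos E F a.1.2 (abs_unitInterval_le a.2))]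
          ring⟩,
        norm_ofReal_sqrt_ne_zero (contract_pos E F a.1.2 (abs_unitInterval_le a.2))⟩)
    (by
      have h1 : Continuous fun a : spaceL E F × unitInterval => (retrL E F).toFun a.1 :=
        (retrL E F).continuous'.comp continuous_fst
      have h2 : Continuous fun a : spaceL E F × unitInterval => compr a.1.1 :=
        continuous_compr.comp (continuous_subtype_val.comp continuous_fst)
      have h3 : Continuous fun a : spaceL E F × unitInterval => F.lineNorm (compr a.1.1) :=
        F.continuous_lineNorm.comp h2
      have h4 : Continuous fun a : spaceL E F × unitInterval => (a.2 : ℝ) := by fun_prop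
      exact Continuous.subtype_mk (Continuous.subtype_mk
        ((E.continuous_lmk.comp (h1.prodMk (by fun_prop))).prodMk
          (F.continuous_scale.comp (h4.prodMk h2))) _) _)
    (fun g (a : spaceL E F × unitInterval) => Subtype.ext (sphere_ext (by
      change E.lmk ((retrL E F).toFun (g • a.1), ((√(1 - (|(a.2 : ℝ)| *
        F.lineNorm (g • compr a.1.1)) ^ 2) : ℝ) : ℂ)) = _
      rw [(retrL E F).map_smul', lineNorm_smul]
      rfl) (F.scale_smul _ g _)))

/-- The contraction onto `F` of the complement of `E`. -/
def contractR : (spaceR E F).cyl ⟶ spaceR E F :=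
  GMap.mk (X := (spaceR E F).cyl) (Y := spaceR E F)
    (fun a : spaceR E F × unitInterval =>
      ⟨⟨(E.scale a.2 (compl a.1.1), F.lmk ((retrR E F).toFun a.1,
            ((√(1 - (|(a.2 : ℝ)| * E.lineNorm (compl a.1.1)) ^ 2) : ℝ) : ℂ))), by
        refine ⟨?_, ?_⟩
        · rw [lineProj_scale, lineProj_comp, ← proj_unit]
          rfl
        · rw [lineNorm_scale, lineNorm_lmk,
            norm_ofReal_sqrt_sq (contract_pos' E F a.1.2 (abs_unitInterval_le a.2))]
          ring⟩,
        norm_ofReal_sqrt_ne_zero (contract_pos' E F a.1.2 (abs_unitInterval_le a.2))⟩)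
    (by
      have h1 : Continuous fun a : spaceR E F × unitInterval => (retrR E F).toFun a.1 :=
        (retrR E F).continuous'.comp continuous_fst
      have h2 : Continuous fun a : spaceR E F × unitInterval => compl a.1.1 :=
        continuous_compl.comp (continuous_subtype_val.comp continuous_fst)
      have h3 : Continuous fun a : spaceR E F × unitInterval => E.lineNorm (compl a.1.1) :=
        E.continuous_lineNorm.comp h2
      have h4 : Continuous fun a : spaceR E F × unitInterval => (a.2 : ℝ) := by fun_prop
      exact Continuous.subtype_mk (Continuous.subtype_mk
        ((E.continuous_scale.comp (h4.prodMk h2)).prodMk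
          (F.continuous_lmk.comp (h1.prodMk (by fun_prop)))) _) _)
    (fun g (a : spaceR E F × unitInterval) => Subtype.ext (sphere_ext (E.scale_smul _ g _) (by
      change F.lmk ((retrR E F).toFun (g • a.1), ((√(1 - (|(a.2 : ℝ)| *
        E.lineNorm (g • compl a.1.1)) ^ 2) : ℝ) : ℂ)) = _
      rw [(retrR E F).map_smul', lineNorm_smul]
      rfl)))

lemma sqrt_one_sub_sq_lineNorm_compr (x : sphere E F) :
    √(1 - F.lineNorm (compr x) ^ 2) = E.lineNorm (compl x) := by
  rw [← lineNorm_comp x, add_sub_cancel_right, Real.sqrt_sq (E.lineNorm_nonneg _)]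

lemma sqrt_one_sub_sq_lineNorm_compl (x : sphere E F) :
    √(1 - E.lineNorm (compl x) ^ 2) = F.lineNorm (compr x) := by
  rw [← lineNorm_comp x, add_sub_cancel_left, Real.sqrt_sq (F.lineNorm_nonneg _)]

lemma cylι_zero_contractL :
    (spaceL E F).cylι 0 ≫ contractL E F = retrL E F ≫ inclL E F := by
  refine GMap.ext (funext fun x => Subtype.ext (sphere_ext ?_ ?_))
  · change E.lmk ((retrL E F).toFun x, ((√(1 - (|(0 : ℝ)| * F.lineNorm (compr x.1)) ^ 2) : ℝ) : ℂ))
      = E.lmk ((retrL E F).toFun x, 1)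
    simp
  · change F.scale 0 (compr x.1) = F.zero (E.proj.toFun (E.unit (compl x.1)))
    rw [scale_zero, proj_unit, lineProj_comp]

lemma cylι_zero_contractR :
    (spaceR E F).cylι 0 ≫ contractR E F = retrR E F ≫ inclR E F := by
  refine GMap.ext (funext fun x => Subtype.ext (sphere_ext ?_ ?_))
  · change E.scale 0 (compl x.1) = E.zero (F.proj.toFun (F.unit (compr x.1)))
    rw [scale_zero, proj_unit, lineProj_comp]
  · change F.lmk ((retrR E F).toFun x, ((√(1 - (|(0 : ℝ)| * E.lineNorm (compl x.1)) ^ 2) : ℝ) : ℂ))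
      = F.lmk ((retrR E F).toFun x, 1)
    simp

lemma cylι_one_contractL : (spaceL E F).cylι 1 ≫ contractL E F = 𝟙 _ := by
  refine GMap.ext (funext fun x => Subtype.ext (sphere_ext ?_ (F.scale_one (compr x.1))))
  change E.lmk (E.unit (compl x.1), ((√(1 - (|(1 : ℝ)| * F.lineNorm (compr x.1)) ^ 2) : ℝ) : ℂ))
    = compl x.1
  rw [abs_one, one_mul, sqrt_one_sub_sq_lineNorm_compr, lmk_unit]

lemma cylι_one_contractR : (spaceR E F).cylι 1 ≫ contractR E F = 𝟙 _ := by
  refine GMap.ext (funext fun x => Subtype.ext (sphere_ext (E.scale_one (compl x.1)) ?_))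
  change F.lmk (F.unit (compr x.1), ((√(1 - (|(1 : ℝ)| * E.lineNorm (compl x.1)) ^ 2) : ℝ) : ℂ))
    = compr x.1
  rw [abs_one, one_mul, sqrt_one_sub_sq_lineNorm_compl, lmk_unit]

/-- The contraction fixes `E` throughout, since scaling fixes the zero section; this is the
stationarity needed in `exists_extension`. -/
lemma cylMap_inclL_contractL :
    GSpace.cylMap (inclL E F) ≫ contractL E F = E.tot.cylProj ≫ inclL E F := by
  refine GMap.ext (funext fun (a : E.tot × unitInterval) => Subtype.ext (sphere_ext ?_
    (F.scale_zero_section a.2 (E.proj.toFun a.1))))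
  change E.lmk ((inclL E F ≫ retrL E F).toFun a.1,
    ((√(1 - (|(a.2 : ℝ)| * F.lineNorm (F.zero (E.proj.toFun a.1))) ^ 2) : ℝ) : ℂ)) =
      E.lmk (a.1, 1)
  rw [inclL_retrL, lineNorm_zero]
  simp
  rfl

lemma cylMap_inclR_contractR :
    GSpace.cylMap (inclR E F) ≫ contractR E F = F.tot.cylProj ≫ inclR E F := by
  refine GMap.ext (funext fun (a : F.tot × unitInterval) => Subtype.ext (sphere_ext
    (E.scale_zero_section a.2 (F.proj.toFun a.1)) ?_))
  change F.lmk ((inclR E F ≫ retrR E F).toFun a.1,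
    ((√(1 - (|(a.2 : ℝ)| * E.lineNorm (E.zero (F.proj.toFun a.1))) ^ 2) : ℝ) : ℂ)) =
      F.lmk (a.1, 1)
  rw [inclR_retrR, lineNorm_zero]
  simp
  rfl

/-! ### Join coordinates on the overlap of the charts -/

lemma proj_retr (x : spaceLR E F) : E.proj.toFun ((jL E F ≫ retrL E F).toFun x) =
    F.proj.toFun ((jR E F ≫ retrR E F).toFun x) := by
  change E.proj.toFun (E.unit (compl x.1)) = F.proj.toFun (F.unit (compr x.1))
  rw [proj_unit, proj_unit, lineProj_comp]

/-- The projection to `E ×_X F` of the complement of `E` and `F`. -/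
def mid : spaceLR E F ⟶ fiberProd E F :=
  GMap.mk (X := spaceLR E F) (Y := fiberProd E F)
    (fun x => ⟨((jL E F ≫ retrL E F).toFun x, (jR E F ≫ retrR E F).toFun x), proj_retr E F x⟩)
    (Continuous.subtype_mk
      ((jL E F ≫ retrL E F).continuous'.prodMk (jR E F ≫ retrR E F).continuous') _)
    (fun g x => Subtype.ext (Prod.ext ((jL E F ≫ retrL E F).map_smul' g x)
      ((jR E F ≫ retrR E F).map_smul' g x)))

lemma lineNorm_compr_le (x : sphere E F) : F.lineNorm (compr x) ≤ 1 := by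
  have := lineNorm_comp x
  nlinarith [sq_nonneg (E.lineNorm (compl x)), F.lineNorm_nonneg (compr x)]

/-- The join coordinate of a point of the sphere bundle. -/
def angle (x : sphere E F) : unitInterval :=
  -- This inverts `s ↦ sin (πs/2)`, the norm of the second component of `join`.
  ⟨2 / Real.pi * Real.arcsin (F.lineNorm (compr x)),
    mul_nonneg (by positivity) (Real.arcsin_nonneg.2 (F.lineNorm_nonneg _)), by
      have h := Real.arcsin_le_pi_div_two (F.lineNorm (compr x))
      rw [div_mul_eq_mul_div, div_le_one Real.pi_pos]
      linarith⟩

lemma continuous_angle : Continuous (angle E F) :=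
  Continuous.subtype_mk (continuous_const.mul
    (Real.continuous_arcsin.comp (F.continuous_lineNorm.comp continuous_compr))) _

lemma angle_smul (g : G) (x : sphere E F) : angle E F (g • x) = angle E F x :=
  Subtype.ext (by simp only [angle, compr_smul, lineNorm_smul])

lemma pi_mul_angle (x : sphere E F) :
    Real.pi * (angle E F x : ℝ) / 2 = Real.arcsin (F.lineNorm (compr x)) := by
  simp only [angle]
  field_simp

lemma cos_pos_of_ne_one {s : unitInterval} (hs : s ≠ 1) : 0 < Real.cos (Real.pi * s / 2) := by
  have h : (s : ℝ) < 1 := lt_of_le_of_ne s.2.2 fun h => hs (Subtype.ext h)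
  refine Real.cos_pos_of_mem_Ioo ⟨?_, ?_⟩ <;> nlinarith [Real.pi_pos, s.2.1]

lemma sin_pos_of_ne_zero {s : unitInterval} (hs : s ≠ 0) : 0 < Real.sin (Real.pi * s / 2) := by
  have h : 0 < (s : ℝ) := lt_of_le_of_ne s.2.1 fun h => hs (Subtype.ext h.symm)
  refine Real.sin_pos_of_pos_of_lt_pi ?_ ?_ <;> nlinarith [Real.pi_pos, s.2.2]

lemma angle_ne_one {x : sphere E F} (hx : x ∈ chartL E F) : angle E F x ≠ 1 := by
  intro h
  apply hx
  rw [← sqrt_one_sub_sq_lineNorm_compr, ← Real.cos_arcsin, ← pi_mul_angle, h]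
  simp

lemma angle_ne_zero {x : sphere E F} (hx : x ∈ chartR E F) : angle E F x ≠ 0 := by
  intro h
  apply hx
  rw [← Real.sin_arcsin (by linarith [F.lineNorm_nonneg (compr x)]) (lineNorm_compr_le E F x),
    ← pi_mul_angle, h]
  simp

variable {E F}

lemma join_mem_chartL {a : (fiberProd E F).cyl} (ha : GSpace.height a ≠ 1) :
    (join E F).toFun a ∈ chartL E F := by
  change ‖((Real.cos (Real.pi * (GSpace.height a : ℝ) / 2) : ℝ) : ℂ)‖ ≠ 0
  rw [norm_ne_zero_iff, Complex.ofReal_ne_zero]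
  exact (cos_pos_of_ne_one ha).ne'

lemma join_mem_chartR {a : (fiberProd E F).cyl} (ha : GSpace.height a ≠ 0) :
    (join E F).toFun a ∈ chartR E F := by
  change ‖((Real.sin (Real.pi * (GSpace.height a : ℝ) / 2) : ℝ) : ℂ)‖ ≠ 0
  rw [norm_ne_zero_iff, Complex.ofReal_ne_zero]
  exact (sin_pos_of_ne_zero ha).ne'

variable {Y : GSpace G} (f : Y ⟶ (fiberProd E F).cyl)

/-- The map to the complement of `F` given by join coordinates. -/
def joinL (hf : ∀ y, GSpace.height (f.toFun y) ≠ 1) : Y ⟶ spaceL E F :=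
  GMap.mk (Y := spaceL E F) (fun y => ⟨(f ≫ join E F).toFun y, join_mem_chartL (hf y)⟩)
    ((f ≫ join E F).continuous'.subtype_mk _)
    (fun g y => Subtype.ext ((f ≫ join E F).map_smul' g y))

/-- The map to the complement of `E` given by join coordinates. -/
def joinR (hf : ∀ y, GSpace.height (f.toFun y) ≠ 0) : Y ⟶ spaceR E F :=
  GMap.mk (Y := spaceR E F) (fun y => ⟨(f ≫ join E F).toFun y, join_mem_chartR (hf y)⟩)
    ((f ≫ join E F).continuous'.subtype_mk _)
    (fun g y => Subtype.ext ((f ≫ join E F).map_smul' g y))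

/-- The map to the complement of `E` and `F` given by join coordinates. -/
def joinLR (hf : ∀ y, GSpace.height (f.toFun y) ≠ 1) (hf' : ∀ y, GSpace.height (f.toFun y) ≠ 0) :
    Y ⟶ spaceLR E F :=
  GMap.mk (Y := spaceLR E F)
    (fun y => ⟨(f ≫ join E F).toFun y, join_mem_chartL (hf y), join_mem_chartR (hf' y)⟩)
    ((f ≫ join E F).continuous'.subtype_mk _)
    (fun g y => Subtype.ext ((f ≫ join E F).map_smul' g y))

/-- Below height `1` the cosine is positive, so normalising the first component forgets the height.
-/
lemma joinL_retrL (hf) : joinL f hf ≫ retrL E F = f ≫ (fiberProd E F).cylProj ≫ fst E F :=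
  GMap.ext (funext fun y => E.unit_lmk_ofReal (cos_pos_of_ne_one (hf y)) _)

lemma joinR_retrR (hf) : joinR f hf ≫ retrR E F = f ≫ (fiberProd E F).cylProj ≫ snd E F :=
  GMap.ext (funext fun y => F.unit_lmk_ofReal (sin_pos_of_ne_zero (hf y)) _)

lemma joinLR_mid (hf hf') : joinLR f hf hf' ≫ mid E F = f ≫ (fiberProd E F).cylProj := by
  refine GMap.ext (funext fun y => Subtype.ext (Prod.ext ?_ ?_))
  · exact E.unit_lmk_ofReal (cos_pos_of_ne_one (hf y)) _
  · exact F.unit_lmk_ofReal (sin_pos_of_ne_zero (hf' y)) _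

variable (E F)

/-- The join coordinates on the complement of `E` and `F`. -/
def coord : spaceLR E F ⟶ (fiberProd E F).cyl :=
  GSpace.toCyl (mid E F) (fun x => angle E F x.1)
    ((continuous_angle E F).comp continuous_subtype_val) (fun g x => angle_smul E F g x.1)

/-- Polar decomposition of both components: if `r` is the second norm, then `sin (arcsin r) = r` and
`cos (arcsin r)` is the first norm. -/
lemma coord_join : coord E F ≫ join E F = jL E F ≫ ιL E F := by
  refine GMap.ext (funext fun x => sphere_ext ?_ ?_)
  · change E.lmk (E.unit (compl x.1),
      ((Real.cos (Real.pi * (angle E F x.1 : ℝ) / 2) : ℝ) : ℂ)) = compl x.1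
    rw [pi_mul_angle, Real.cos_arcsin, sqrt_one_sub_sq_lineNorm_compr, lmk_unit]
  · change F.lmk (F.unit (compr x.1),
      ((Real.sin (Real.pi * (angle E F x.1 : ℝ) / 2) : ℝ) : ℂ)) = compr x.1
    rw [pi_mul_angle, Real.sin_arcsin (by linarith [F.lineNorm_nonneg (compr x.1)])
      (lineNorm_compr_le E F x.1), lmk_unit]

/-- The homotopy `((x, s), t) ↦ (x, s t)` from the bottom of the cylinder to the join
coordinates. -/
def slideL : (spaceLR E F).cyl ⟶ (fiberProd E F).cyl :=
  GSpace.toCyl (Y := (spaceLR E F).cyl) ((spaceLR E F).cylProj ≫ mid E F)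
    (fun a : spaceLR E F × unitInterval => a.2 * angle E F a.1.1)
    (continuous_snd.mul ((continuous_angle E F).comp (continuous_subtype_val.comp continuous_fst)))
    (fun g (a : spaceLR E F × unitInterval) => congrArg (a.2 * ·) (angle_smul E F g a.1.1))

/-- The homotopy `((x, s), t) ↦ (x, 1 - (1 - s) t)` from the top of the cylinder to the join
coordinates. -/
def slideR : (spaceLR E F).cyl ⟶ (fiberProd E F).cyl :=
  GSpace.toCyl (Y := (spaceLR E F).cyl) ((spaceLR E F).cylProj ≫ mid E F)
    (fun a : spaceLR E F × unitInterval => unitInterval.symm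
      (a.2 * unitInterval.symm (angle E F a.1.1)))
    (unitInterval.continuous_symm.comp (continuous_snd.mul (unitInterval.continuous_symm.comp
      ((continuous_angle E F).comp (continuous_subtype_val.comp continuous_fst)))))
    (fun g (a : spaceLR E F × unitInterval) =>
      congrArg (fun s => unitInterval.symm (a.2 * unitInterval.symm s)) (angle_smul E F g a.1.1))

lemma mul_ne_one_of_right {s t : unitInterval} (ht : t ≠ 1) : s * t ≠ 1 := by
  intro h
  apply ht
  refine le_antisymm unitInterval.le_one' ?_
  rw [← h]
  exact unitInterval.mul_le_right

/-- The angle is below `1` on the overlap and the slide only lowers it, so the whole homotopy stays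
in the chart around `E`. -/
lemma height_slideL (a : (spaceLR E F).cyl) : GSpace.height ((slideL E F).toFun a) ≠ 1 :=
  mul_ne_one_of_right (angle_ne_one E F a.1.2.1)

lemma height_slideR (a : (spaceLR E F).cyl) : GSpace.height ((slideR E F).toFun a) ≠ 0 := by
  change unitInterval.symm _ ≠ 0
  rw [Ne, unitInterval.symm_eq_zero]
  refine mul_ne_one_of_right ?_
  rw [Ne, unitInterval.symm_eq_one]
  exact angle_ne_zero E F a.1.2.2

lemma cylι_zero_slideL :
    (spaceLR E F).cylι 0 ≫ slideL E F = mid E F ≫ (fiberProd E F).cylι 0 :=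
  GMap.ext (funext fun x => Prod.ext rfl (zero_mul (angle E F x.1)))

lemma cylι_one_slideL : (spaceLR E F).cylι 1 ≫ slideL E F = coord E F :=
  GMap.ext (funext fun x => Prod.ext rfl (one_mul (angle E F x.1)))

lemma cylι_zero_slideR :
    (spaceLR E F).cylι 0 ≫ slideR E F = mid E F ≫ (fiberProd E F).cylι 1 :=
  GMap.ext (funext fun x => Prod.ext rfl (by
    change unitInterval.symm (0 * unitInterval.symm (angle E F x.1)) = 1
    rw [zero_mul, unitInterval.symm_zero]))

lemma cylι_one_slideR : (spaceLR E F).cylι 1 ≫ slideR E F = coord E F :=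
  GMap.ext (funext fun x => Prod.ext rfl (by
    change unitInterval.symm (1 * unitInterval.symm (angle E F x.1)) = angle E F x.1
    rw [one_mul, unitInterval.symm_symm]))

/-- The midpoint of `[0,1]`. -/
def half : unitInterval := ⟨1 / 2, by norm_num, by norm_num⟩

lemma half_ne_one : half ≠ 1 := fun h => by
  have := congrArg Subtype.val h
  norm_num [half] at this

lemma half_ne_zero : half ≠ 0 := fun h => by
  have := congrArg Subtype.val h
  norm_num [half] at this

lemma symm_half : unitInterval.symm half = half :=
  Subtype.ext (by norm_num [half])

/-- The map `(z, t) ↦ (z, (1 + t) / 2)`. -/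
def upper : (fiberProd E F).cyl ⟶ (fiberProd E F).cyl :=
  GSpace.toCyl (Y := (fiberProd E F).cyl) (fiberProd E F).cylProj
    (fun a => unitInterval.symm (unitInterval.symm (GSpace.height a) * half))
    (unitInterval.continuous_symm.comp
      ((unitInterval.continuous_symm.comp GSpace.continuous_height).mul continuous_const))
    (fun _ _ => rfl)

lemma height_upper (a : (fiberProd E F).cyl) : GSpace.height ((upper E F).toFun a) ≠ 0 := by
  change unitInterval.symm _ ≠ 0
  rw [Ne, unitInterval.symm_eq_zero]
  exact mul_ne_one_of_right half_ne_one

lemma cylι_zero_upper : (fiberProd E F).cylι 0 ≫ upper E F = (fiberProd E F).cylι half :=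
  GMap.ext (funext fun x => Prod.ext rfl (by
    change unitInterval.symm (unitInterval.symm 0 * half) = half
    rw [unitInterval.symm_zero, one_mul, symm_half]))

lemma cylι_one_upper : (fiberProd E F).cylι 1 ≫ upper E F = (fiberProd E F).cylι 1 :=
  GMap.ext (funext fun x => Prod.ext rfl (by
    change unitInterval.symm (unitInterval.symm 1 * half) = 1
    rw [unitInterval.symm_one, zero_mul, unitInterval.symm_zero]))

/-- The inclusion of `E ×_X F` at the middle of the join. -/
def midIncl : fiberProd E F ⟶ spaceLR E F :=
  joinLR ((fiberProd E F).cylι half) (fun _ => half_ne_one) (fun _ => half_ne_zero)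

lemma midIncl_coord : midIncl E F ≫ coord E F = (fiberProd E F).cylι half := by
  refine GMap.ext (funext fun x => Prod.ext (congrFun (congrArg GMap.toFun
    (joinLR_mid ((fiberProd E F).cylι half) (fun _ => half_ne_one) (fun _ => half_ne_zero))) x)
    (Subtype.ext ?_))
  change 2 / Real.pi * Real.arcsin ‖((Real.sin (Real.pi * (half : ℝ) / 2) : ℝ) : ℂ)‖ = half
  have hp := Real.pi_pos
  rw [Complex.norm_real, Real.norm_of_nonneg (sin_pos_of_ne_zero half_ne_zero).le,
    Real.arcsin_sin (by norm_num [half]; linarith) (by norm_num [half]; linarith)]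
  field_simp

end CircleBundle

section Main

open CircleBundle

/-! ### Extension and comparison of morphisms of twisted spaces -/

namespace TwistedSpace

variable [IsTopologicalGroup G] {M : TwistModel.{u, v, w} G}

/-- Two morphisms that agree at the start of a homotopy agree at its end. -/
lemma comp_eq_comp_of_homotopy {Y : GSpace G} (hY : M.Good Y) {B : M.Tw Y}
    {C₁ C₂ D₁ D₂ T : TwistedSpace M} (r₁ : C₁ ⟶ D₁) (r₂ : C₂ ⟶ D₂) (f₁ : C₁ ⟶ T) (f₂ : C₂ ⟶ T)
    (q₁ : mk Y B ⟶ D₁) (q₂ : mk Y B ⟶ D₂) (s₁ : Y.cyl ⟶ C₁.space) (s₂ : Y.cyl ⟶ C₂.space)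
    (h₁ : s₁ ≫ r₁.base = Y.cylProj ≫ q₁.base) (h₂ : s₂ ≫ r₂.base = Y.cylProj ≫ q₂.base)
    (hf : s₁ ≫ f₁.base = s₂ ≫ f₂.base)
    {k₁ l₁ : mk Y B ⟶ C₁} {k₂ l₂ : mk Y B ⟶ C₂}
    (hk₁ : k₁.base = Y.cylι 0 ≫ s₁) (hk₂ : k₂.base = Y.cylι 0 ≫ s₂)
    (hl₁ : l₁.base = Y.cylι 1 ≫ s₁) (hl₂ : l₂.base = Y.cylι 1 ≫ s₂)
    (hk₁' : k₁ ≫ r₁ = q₁) (hk₂' : k₂ ≫ r₂ = q₂) (hl₁' : l₁ ≫ r₁ = q₁) (hl₂' : l₂ ≫ r₂ = q₂)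
    (h : k₁ ≫ f₁ = k₂ ≫ f₂) : l₁ ≫ f₁ = l₂ ≫ f₂ := by
  -- Each `sᵢ` is constant after `rᵢ`; lift it so that the twisted map is constant at `qᵢ` as well.
  obtain ⟨K₁, hK₁, hK₁'⟩ := exists_lift r₁ (cart Y.cylProj B ≫ q₁) s₁ h₁
  obtain ⟨K₂, hK₂, hK₂'⟩ := exists_lift r₂ (cart Y.cylProj B ≫ q₂) s₂ h₂
  -- Since `r` is cartesian, the restrictions of these lifts to the ends are forced.
  have e (s : unitInterval) {C D : TwistedSpace M} {r : C ⟶ D} {q : mk Y B ⟶ D}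
      {K : mk Y.cyl ((M.pull Y.cylProj).obj B) ⟶ C} {σ : Y.cyl ⟶ C.space} (hK : K.base = σ)
      (hK' : K ≫ r = cart Y.cylProj B ≫ q) {k : mk Y B ⟶ C} (hk : k.base = Y.cylι s ≫ σ)
      (hk' : k ≫ r = q) : cylIncl B s ≫ K = k := by
    refine hom_ext r ?_ ?_
    · rw [hk, comp_base, hK]
      rfl
    · rw [Category.assoc, hK', ← Category.assoc, cylIncl_comp_cart, Category.id_comp, hk']
  rw [← e 1 hK₁ hK₁' hl₁ hl₁', ← e 1 hK₂ hK₂' hl₂ hl₂', Category.assoc, Category.assoc]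
  apply comp_eq_of_homotopy hY
  · rw [comp_base, comp_base, hK₁, hK₂]
    exact hf
  · rw [← Category.assoc, ← Category.assoc, e 0 hK₁ hK₁' hk₁ hk₁', e 0 hK₂ hK₂' hk₂ hk₂', h]

/-- Extension of a morphism along a deformation retract. -/
lemma exists_extension {A U : GSpace G} (hA : M.Good A) (hU : M.Good U) {P : M.Tw A} {N : M.Tw U}
    {T : TwistedSpace M} (ρ : mk U N ⟶ mk A P) (κ : mk A P ⟶ mk U N) (hκ : κ ≫ ρ = 𝟙 _)
    (H : U.cyl ⟶ U) (h0 : U.cylι 0 ≫ H = ρ.base ≫ κ.base) (h1 : U.cylι 1 ≫ H = 𝟙 U)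
    (hH : GSpace.cylMap κ.base ≫ H = A.cylProj ≫ κ.base) (a : mk A P ⟶ T) (c : U ⟶ T.space)
    (hc : κ.base ≫ c = a.base) : ∃ ψ : mk U N ⟶ T, ψ.base = c ∧ κ ≫ ψ = a := by
  -- Start from `a` after the retraction and lift the deformation; the end of the lift is the
  -- extension.
  obtain ⟨Θ, hΘ, hΘ'⟩ := exists_cyl_lift hU (cylIncl N 0) rfl (ρ ≫ a) (H ≫ c) (by
    rw [← Category.assoc, h0, Category.assoc]
    exact congrArg (ρ.base ≫ ·) hc)
  refine ⟨cylIncl N 1 ≫ Θ, ?_, ?_⟩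
  · rw [comp_base, hΘ]
    change U.cylι 1 ≫ H ≫ c = c
    rw [← Category.assoc, h1, Category.id_comp]
  -- Over `A` the deformation is stationary, so the lift restricts at time `1` to what it is at time
  -- `0`, namely `κ ≫ ρ ≫ a = a`.
  · have h := comp_eq_comp_of_homotopy hA (cart U.cylProj N) (𝟙 (mk A P)) Θ a κ (𝟙 _)
      (GSpace.cylMap κ.base) A.cylProj rfl rfl (by
        rw [hΘ]
        change (GSpace.cylMap κ.base ≫ H) ≫ c = _
        rw [hH, Category.assoc]
        exact congrArg (A.cylProj ≫ ·) hc)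
      (k₁ := κ ≫ cylIncl N 0) (l₁ := κ ≫ cylIncl N 1) (k₂ := 𝟙 _) (l₂ := 𝟙 _) rfl rfl rfl rfl
      (by rw [Category.assoc, cylIncl_comp_cart, Category.comp_id]) (Category.id_comp _)
      (by rw [Category.assoc, cylIncl_comp_cart, Category.comp_id]) (Category.id_comp _)
      (by rw [Category.assoc, hΘ', ← Category.assoc, hκ])
    rw [Category.id_comp, Category.assoc] at h
    exact h

end TwistedSpace

/-! ### Twists on the sphere bundle -/

open TwistedSpace

variable {M : TwistModel.{u, v, w} G} {X : GSpace G} {E F : CircleBundle X}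
  {P : M.Tw E.tot} {Q : M.Tw F.tot}

/-- The inclusion `(E, P) ⟶ (S(E, F), T)`. -/
def leftHom (T : SphereTwist M P Q) : mk E.tot P ⟶ mk (sphere E F) T.tw :=
  ⟨inl E F, T.resl.inv⟩

/-- The inclusion `(F, Q) ⟶ (S(E, F), T)`. -/
def rightHom (T : SphereTwist M P Q) : mk F.tot Q ⟶ mk (sphere E F) T.tw :=
  ⟨inr E F, T.resr.inv⟩

/-- The morphism over `E ×_X F ⟶ F` given by `u : p^*P ≅ p̂^*Q`. -/
def toRight (u : (M.pull (fst E F)).obj P ≅ (M.pull (snd E F)).obj Q) :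
    mk (fiberProd E F) ((M.pull (fst E F)).obj P) ⟶ mk F.tot Q :=
  ⟨snd E F, u.hom⟩

/-- All later arguments use this form: a lift of the join homotopy with prescribed ends. Its twist
component is automatically invertible, the fibres being groupoids. -/
lemma induces_iff (T : SphereTwist M P Q)
    (u : (M.pull (fst E F)).obj P ≅ (M.pull (snd E F)).obj Q) :
    Induces T u ↔ ∃ Θ : mk (fiberProd E F).cyl
        ((M.pull (fiberProd E F).cylProj).obj ((M.pull (fst E F)).obj P)) ⟶ mk (sphere E F) T.tw,
      Θ.base = join E F ∧ cylIncl _ 0 ≫ Θ = cart (fst E F) P ≫ leftHom T ∧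
        cylIncl _ 1 ≫ Θ = toRight u ≫ rightHom T := by
  have hl : leftHom T = vert T.resl.inv ≫ cart _ _ := (vert_comp_cart _ _).symm
  have hr : rightHom T = vert T.resr.inv ≫ cart _ _ := (vert_comp_cart _ _).symm
  have hu : toRight u = vert u.hom ≫ cart _ _ := (vert_comp_cart _ _).symm
  rw [hl, hr, hu]
  constructor
  · rintro ⟨Θ, h0, h1⟩
    rw [slice_eq_iff] at h0 h1
    refine ⟨vert Θ.hom ≫ cart (join E F) T.tw, rfl, ?_, ?_⟩
    · rw [h0, Iso.refl_hom, vert_id, Category.id_comp]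
    · rw [h1, Category.assoc]
  · rintro ⟨⟨c, φ⟩, hc, h0, h1⟩
    obtain rfl : c = join E F := hc
    rw [← vert_comp_cart] at h0 h1
    refine ⟨asIso φ, ?_, ?_⟩
    · rw [slice_eq_iff, Iso.refl_hom, vert_id, Category.id_comp]
      exact h0
    · rw [slice_eq_iff, asIso_hom, h1, Category.assoc]

/-- Lift the join homotopy from its bottom; the top end factors through the cartesian morphism
`rightHom T`, and the factor is `u`. -/
lemma exists_induces [IsTopologicalGroup G] (hEF : M.Good (fiberProd E F)) (T : SphereTwist M P Q) :
    ∃ u, Induces T u := by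
  obtain ⟨Θ, hΘ, hΘ'⟩ := exists_cyl_lift hEF (cylIncl ((M.pull (fst E F)).obj P) 0) rfl
    (cart (fst E F) P ≫ leftHom T) (join E F) (join_zero E F)
  obtain ⟨⟨s, κ⟩, hs, hs'⟩ := exists_lift (rightHom T) (cylIncl _ 1 ≫ Θ) (snd E F) (by
    rw [comp_base, hΘ]
    exact (join_one E F).symm)
  obtain rfl : s = snd E F := hs
  exact ⟨asIso κ, (induces_iff T _).2 ⟨Θ, hΘ, hΘ', hs'.symm⟩⟩

lemma induces_unique [IsTopologicalGroup G] (hEF : M.Good (fiberProd E F)) {T : SphereTwist M P Q}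
    {u u' : (M.pull (fst E F)).obj P ≅ (M.pull (snd E F)).obj Q}
    (h : Induces T u) (h' : Induces T u') : u = u' := by
  obtain ⟨Θ, hb, h0, h1⟩ := (induces_iff T u).1 h
  obtain ⟨Θ', hb', h0', h1'⟩ := (induces_iff T u').1 h'
  obtain rfl : Θ = Θ' := cyl_ext hEF (cylIncl _ 0) rfl (hb.trans hb'.symm) (h0.trans h0'.symm)
  have h2 : toRight u = toRight u' := hom_ext (rightHom T) rfl (h1.symm.trans h1')
  apply Iso.ext
  injection h2

lemma good_spaceL (hS : M.Good (sphere E F)) : M.Good (spaceL E F) :=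
  M.good_open _ _ _ hS (isOpen_chartL E F)

lemma good_spaceR (hS : M.Good (sphere E F)) : M.Good (spaceR E F) :=
  M.good_open _ _ _ hS (isOpen_chartR E F)

lemma good_spaceLR (hS : M.Good (sphere E F)) : M.Good (spaceLR E F) :=
  M.good_open _ _ _ hS ((isOpen_chartL E F).inter (isOpen_chartR E F))

/-! ### Lifted join homotopy against chart data on the overlap -/

section Charts

variable (P Q) in
lemma exists_inclL_lift : ∃ κ : mk E.tot P ⟶ mk (spaceL E F) ((M.pull (retrL E F)).obj P),
    κ.base = inclL E F ∧ κ ≫ cart (retrL E F) P = 𝟙 _ :=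
  exists_lift (cart (retrL E F) P) (𝟙 _) (inclL E F) (inclL_retrL E F)

variable (P Q) in
lemma exists_inclR_lift : ∃ κ : mk F.tot Q ⟶ mk (spaceR E F) ((M.pull (retrR E F)).obj Q),
    κ.base = inclR E F ∧ κ ≫ cart (retrR E F) Q = 𝟙 _ :=
  exists_lift (cart (retrR E F) Q) (𝟙 _) (inclR E F) (inclR_retrR E F)

/-- The pullback of `P` to the complement of `E` and `F`. -/
abbrev midTw (F : CircleBundle X) (P : M.Tw E.tot) : M.Tw (spaceLR E F) := (M.pull (mid E F)).obj ((M.pull (fst E F)).obj P)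

/-- The pullback of `P` to the cylinder over `E ×_X F`. -/
abbrev cylTw (F : CircleBundle X) (P : M.Tw E.tot) : M.Tw (fiberProd E F).cyl :=
  (M.pull (fiberProd E F).cylProj).obj ((M.pull (fst E F)).obj P)

/-- Slide from the bottom of the join up to the actual join coordinate, inside the chart around `E`.
Both sides are ends of lifts of this homotopy that agree at the bottom by `h0`. -/
lemma comparison_left [IsTopologicalGroup G] (hS : M.Good (sphere E F)) {S : M.Tw (sphere E F)}
    (Θ : mk (fiberProd E F).cyl (cylTw F P) ⟶ mk (sphere E F) S) (hΘ : Θ.base = join E F)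
    {k : mk (spaceLR E F) (midTw F P) ⟶ mk (fiberProd E F).cyl (cylTw F P)}
    (hk : k.base = coord E F) (hk' : k ≫ cart _ _ = cart _ _)
    {κ : mk E.tot P ⟶ mk (spaceL E F) ((M.pull (retrL E F)).obj P)}
    (hκ : κ.base = inclL E F) (hκ' : κ ≫ cart (retrL E F) P = 𝟙 _)
    {α : mk (spaceLR E F) (midTw F P) ⟶ mk (spaceL E F) ((M.pull (retrL E F)).obj P)}
    (hα : α.base = jL E F) (hα' : α ≫ cart _ _ = cart _ _ ≫ cart _ _)
    {ψ : mk (spaceL E F) ((M.pull (retrL E F)).obj P) ⟶ mk (sphere E F) S}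
    (hψ : ψ.base = ιL E F) (h0 : cylIncl _ 0 ≫ Θ = cart (fst E F) P ≫ κ ≫ ψ) :
    k ≫ Θ = α ≫ ψ := by
  refine comp_eq_comp_of_homotopy (good_spaceLR hS) (cart _ _) (cart _ _) Θ ψ (cart _ _)
    (cart _ _ ≫ cart _ _) (slideL E F) (joinL (slideL E F) (height_slideL E F)) rfl
    (joinL_retrL _ _) ?_ (k₁ := cart _ _ ≫ cylIncl _ 0) (k₂ := cart _ _ ≫ cart _ _ ≫ κ)
    ?_ ?_ ?_ ?_ ?_ ?_ hk' hα' ?_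
  · rw [hΘ, hψ]
    rfl
  · exact (cylι_zero_slideL E F).symm
  · rw [comp_base, comp_base, hκ]
    apply spaceL_hom_ext
    change mid E F ≫ fst E F ≫ inl E F = ((spaceLR E F).cylι 0 ≫ slideL E F) ≫ join E F
    rw [cylι_zero_slideL, Category.assoc, join_zero]
  · rw [hk, cylι_one_slideL]
  · rw [hα]
    apply spaceL_hom_ext
    change _ = ((spaceLR E F).cylι 1 ≫ slideL E F) ≫ join E F
    rw [cylι_one_slideL, coord_join]
  · rw [Category.assoc, cylIncl_comp_cart, Category.comp_id]
  · rw [Category.assoc, Category.assoc, hκ', Category.comp_id]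
  · simp only [Category.assoc, h0]

/-- The mirror argument slides down from the top of the join, where the two lifts are compared
through `u`. -/
lemma comparison_right [IsTopologicalGroup G] (hS : M.Good (sphere E F)) {S : M.Tw (sphere E F)}
    {u : (M.pull (fst E F)).obj P ≅ (M.pull (snd E F)).obj Q}
    (Θ : mk (fiberProd E F).cyl (cylTw F P) ⟶ mk (sphere E F) S) (hΘ : Θ.base = join E F)
    {k : mk (spaceLR E F) (midTw F P) ⟶ mk (fiberProd E F).cyl (cylTw F P)}
    (hk : k.base = coord E F) (hk' : k ≫ cart _ _ = cart _ _)
    {κ : mk F.tot Q ⟶ mk (spaceR E F) ((M.pull (retrR E F)).obj Q)}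
    (hκ : κ.base = inclR E F) (hκ' : κ ≫ cart (retrR E F) Q = 𝟙 _)
    {α : mk (spaceLR E F) (midTw F P) ⟶ mk (spaceR E F) ((M.pull (retrR E F)).obj Q)}
    (hα : α.base = jR E F) (hα' : α ≫ cart _ _ = cart _ _ ≫ toRight u)
    {ψ : mk (spaceR E F) ((M.pull (retrR E F)).obj Q) ⟶ mk (sphere E F) S}
    (hψ : ψ.base = ιR E F) (h0 : cylIncl _ 1 ≫ Θ = toRight u ≫ κ ≫ ψ) :
    k ≫ Θ = α ≫ ψ := by
  refine comp_eq_comp_of_homotopy (good_spaceLR hS) (cart _ _) (cart _ _) Θ ψ (cart _ _)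
    (cart _ _ ≫ toRight u) (slideR E F) (joinR (slideR E F) (height_slideR E F)) rfl
    (joinR_retrR _ _) ?_ (k₁ := cart _ _ ≫ cylIncl _ 1) (k₂ := cart _ _ ≫ toRight u ≫ κ)
    ?_ ?_ ?_ ?_ ?_ ?_ hk' hα' ?_
  · rw [hΘ, hψ]
    rfl
  · exact (cylι_zero_slideR E F).symm
  · rw [comp_base, comp_base, hκ]
    apply spaceR_hom_ext
    change mid E F ≫ snd E F ≫ inr E F = ((spaceLR E F).cylι 0 ≫ slideR E F) ≫ join E F
    rw [cylι_zero_slideR, Category.assoc, join_one]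
  · rw [hk, cylι_one_slideR]
  · rw [hα]
    apply spaceR_hom_ext
    change _ = ((spaceLR E F).cylι 1 ≫ slideR E F) ≫ join E F
    rw [cylι_one_slideR, coord_join]
    rfl
  · rw [Category.assoc, cylIncl_comp_cart, Category.comp_id]
  · rw [Category.assoc, Category.assoc, hκ', Category.comp_id]
  · simp only [Category.assoc, h0]

end Charts

lemma exists_glued_sphereTwist {S : M.Tw (sphere E F)} (a : mk E.tot P ⟶ mk (sphere E F) S)
    (b : mk F.tot Q ⟶ mk (sphere E F) S) (ha : a.base = inl E F) (hb : b.base = inr E F) :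
    ∃ (l : (M.pull (inl E F)).obj S ≅ P) (r : (M.pull (inr E F)).obj S ≅ Q),
      leftHom ⟨S, l, r⟩ = a ∧ rightHom ⟨S, l, r⟩ = b := by
  obtain ⟨i, a⟩ := a
  obtain ⟨j, b⟩ := b
  obtain rfl : i = inl E F := ha
  obtain rfl : j = inr E F := hb
  exact ⟨(asIso a).symm, (asIso b).symm, rfl, rfl⟩

variable (P) in
lemma exists_coord_lift : ∃ k : mk (spaceLR E F) (midTw F P) ⟶ mk (fiberProd E F).cyl (cylTw F P),
    k.base = coord E F ∧ k ≫ cart _ _ = cart _ _ :=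
  exists_lift (cart _ _) (cart _ _) (coord E F) rfl

variable (P) in
lemma exists_jL_lift : ∃ α : mk (spaceLR E F) (midTw F P) ⟶
      mk (spaceL E F) ((M.pull (retrL E F)).obj P),
    α.base = jL E F ∧ α ≫ cart (retrL E F) P = cart (mid E F) _ ≫ cart (fst E F) P :=
  exists_lift (cart _ _) (cart _ _ ≫ cart _ _) (jL E F) rfl

/-- Here `u` enters the gluing data: the overlap carries the pullback of `P`, matched with the
pullback of `Q` through `u`. -/
lemma exists_jR_lift (u : (M.pull (fst E F)).obj P ≅ (M.pull (snd E F)).obj Q) :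
    ∃ β : mk (spaceLR E F) (midTw F P) ⟶ mk (spaceR E F) ((M.pull (retrR E F)).obj Q),
      β.base = jR E F ∧ β ≫ cart (retrR E F) Q = cart (mid E F) _ ≫ toRight u :=
  exists_lift (cart _ _) (cart _ _ ≫ toRight u) (jR E F) rfl

lemma exists_glue_sphere (hS : M.Good (sphere E F)) {N : M.Tw (spaceL E F)}
    {N' : M.Tw (spaceR E F)} {R : M.Tw (spaceLR E F)} (α : mk (spaceLR E F) R ⟶ mk (spaceL E F) N)
    (β : mk (spaceLR E F) R ⟶ mk (spaceR E F) N') (hα : α.base = jL E F) (hβ : β.base = jR E F) :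
    ∃ (S : M.Tw (sphere E F)) (ψL : mk (spaceL E F) N ⟶ mk (sphere E F) S)
      (ψR : mk (spaceR E F) N' ⟶ mk (sphere E F) S),
      ψL.base = ιL E F ∧ ψR.base = ιR E F ∧ α ≫ ψL = β ≫ ψR :=
  exists_glue (X := sphere E F) hS (isOpen_chartL E F) (isOpen_chartR E F)
    (chartL_union_chartR E F) α β hα hβ

lemma exists_iso_of_glue_sphere (hS : M.Good (sphere E F)) {N : M.Tw (spaceL E F)}
    {N' : M.Tw (spaceR E F)} {R : M.Tw (spaceLR E F)} (α : mk (spaceLR E F) R ⟶ mk (spaceL E F) N)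
    (β : mk (spaceLR E F) R ⟶ mk (spaceR E F) N') (hα : α.base = jL E F) (hβ : β.base = jR E F)
    {S S' : M.Tw (sphere E F)} {ψL : mk (spaceL E F) N ⟶ mk (sphere E F) S}
    {ψR : mk (spaceR E F) N' ⟶ mk (sphere E F) S} {ψL' : mk (spaceL E F) N ⟶ mk (sphere E F) S'}
    {ψR' : mk (spaceR E F) N' ⟶ mk (sphere E F) S'} (hψL : ψL.base = ιL E F)
    (hψR : ψR.base = ιR E F) (hψL' : ψL'.base = ιL E F) (hψR' : ψR'.base = ιR E F)
    (h : α ≫ ψL = β ≫ ψR) (h' : α ≫ ψL' = β ≫ ψR') :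
    ∃ θ : S ≅ S', ψL ≫ vert θ.hom = ψL' ∧ ψR ≫ vert θ.hom = ψR' :=
  exists_iso_of_glue (X := sphere E F) hS (isOpen_chartL E F) (isOpen_chartR E F)
    (chartL_union_chartR E F) α β hα hβ hψL hψR hψL' hψR' h h'

/-- Every isomorphism `p^*P ≅ p̂^*Q` is induced by a twist on the sphere bundle. -/
lemma exists_sphereTwist_induces [IsTopologicalGroup G] (hEF : M.Good (fiberProd E F))
    (hS : M.Good (sphere E F)) (u : (M.pull (fst E F)).obj P ≅ (M.pull (snd E F)).obj Q) :
    ∃ T : SphereTwist M P Q, Induces T u := by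
  obtain ⟨κL, hκL, hκL'⟩ := exists_inclL_lift (F := F) P
  obtain ⟨κR, hκR, hκR'⟩ := exists_inclR_lift (E := E) Q
  obtain ⟨k, hk, hk'⟩ := exists_coord_lift (F := F) P
  obtain ⟨α, hα, hα'⟩ := exists_jL_lift (F := F) P
  obtain ⟨β, hβ, hβ'⟩ := exists_jR_lift u
  obtain ⟨S, ψL, ψR, hψL, hψR, hψ⟩ := exists_glue_sphere hS α β hα hβ
  -- The identifications over `E` and `F` are those read off from the two charts.
  obtain ⟨l, r, hl, hr⟩ := exists_glued_sphereTwist (κL ≫ ψL) (κR ≫ ψR)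
    (by rw [comp_base, hκL, hψL]; rfl) (by rw [comp_base, hκR, hψR]; rfl)
  refine ⟨⟨S, l, r⟩, (induces_iff _ u).2 ?_⟩
  obtain ⟨Θ, hΘ, hΘ0⟩ := exists_cyl_lift hEF (cylIncl ((M.pull (fst E F)).obj P) 0) rfl
    (cart (fst E F) P ≫ leftHom ⟨S, l, r⟩) (join E F) (join_zero E F)
  refine ⟨Θ, hΘ, hΘ0, ?_⟩
  rw [hl] at hΘ0
  rw [hr, ← Category.assoc]
  have hc := comparison_left hS Θ hΘ hk hk' hκL hκL' hα hα' hψL hΘ0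
  -- At height `1/2` both charts are available: there `Θ` is known through the left chart by `hc`,
  -- and gluing converts this to the right chart. Sliding from `1/2` to `1` inside the right chart
  -- then computes the top end of `Θ`.
  obtain ⟨m, hm, hm'⟩ := exists_lift (cart (mid E F) ((M.pull (fst E F)).obj P)) (𝟙 _)
    (midIncl E F) (joinLR_mid _ _ _)
  refine comp_eq_comp_of_homotopy hEF (cart _ _) (cart _ _) Θ ψR (𝟙 _) (toRight u)
    (upper E F) (joinR (upper E F) (height_upper E F)) rfl (joinR_retrR _ _) ?_
    (k₁ := m ≫ k) (k₂ := m ≫ β) ?_ ?_ ?_ ?_ ?_ ?_ (cylIncl_comp_cart _ _) ?_ ?_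
  · rw [hΘ, hψR]
    rfl
  · rw [comp_base, hm, hk, cylι_zero_upper, ← midIncl_coord]
  · rw [comp_base, hm, hβ]
    apply spaceR_hom_ext
    change midIncl E F ≫ jR E F ≫ ιR E F =
      ((fiberProd E F).cylι 0 ≫ upper E F) ≫ join E F
    rw [cylι_zero_upper]
    rfl
  · exact (cylι_one_upper E F).symm
  · rw [comp_base, hκR]
    apply spaceR_hom_ext
    change snd E F ≫ inr E F = ((fiberProd E F).cylι 1 ≫ upper E F) ≫ join E F
    rw [cylι_one_upper, join_one]
  · rw [Category.assoc, hk', hm']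
  · rw [Category.assoc, hβ', ← Category.assoc, hm', Category.id_comp]
  · rw [Category.assoc, hκR', Category.comp_id]
  · rw [Category.assoc, Category.assoc, hc, hψ]

/-- Any twist inducing `u` solves the gluing problem determined by `u`: the identifications extend
along the contractions, and on the overlap both extensions equal the lifted join homotopy in join
coordinates. -/
lemma exists_charts [IsTopologicalGroup G] (hE : M.Good E.tot) (hF : M.Good F.tot)
    (hS : M.Good (sphere E F)) {T : SphereTwist M P Q}
    {u : (M.pull (fst E F)).obj P ≅ (M.pull (snd E F)).obj Q} (h : Induces T u)
    {κL : mk E.tot P ⟶ mk (spaceL E F) ((M.pull (retrL E F)).obj P)}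
    (hκL : κL.base = inclL E F) (hκL' : κL ≫ cart (retrL E F) P = 𝟙 _)
    {κR : mk F.tot Q ⟶ mk (spaceR E F) ((M.pull (retrR E F)).obj Q)}
    (hκR : κR.base = inclR E F) (hκR' : κR ≫ cart (retrR E F) Q = 𝟙 _)
    {α : mk (spaceLR E F) (midTw F P) ⟶ mk (spaceL E F) ((M.pull (retrL E F)).obj P)}
    (hα : α.base = jL E F)
    (hα' : α ≫ cart (retrL E F) P = cart (mid E F) _ ≫ cart (fst E F) P)
    {β : mk (spaceLR E F) (midTw F P) ⟶ mk (spaceR E F) ((M.pull (retrR E F)).obj Q)}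
    (hβ : β.base = jR E F) (hβ' : β ≫ cart (retrR E F) Q = cart (mid E F) _ ≫ toRight u) :
    ∃ (ψL : mk (spaceL E F) ((M.pull (retrL E F)).obj P) ⟶ mk (sphere E F) T.tw)
      (ψR : mk (spaceR E F) ((M.pull (retrR E F)).obj Q) ⟶ mk (sphere E F) T.tw),
      ψL.base = ιL E F ∧ ψR.base = ιR E F ∧ κL ≫ ψL = leftHom T ∧ κR ≫ ψR = rightHom T ∧
        α ≫ ψL = β ≫ ψR := by
  obtain ⟨Θ, hΘ, h0, h1⟩ := (induces_iff T u).1 h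
  obtain ⟨k, hk, hk'⟩ := exists_coord_lift (F := F) P
  obtain ⟨ψL, hψL, hψL'⟩ := exists_extension hE (good_spaceL hS) (cart (retrL E F) P) κL hκL'
    (contractL E F) (by rw [hκL]; exact cylι_zero_contractL E F) (cylι_one_contractL E F)
    (by rw [hκL]; exact cylMap_inclL_contractL E F) (leftHom T) (ιL E F) (by rw [hκL]; rfl)
  obtain ⟨ψR, hψR, hψR'⟩ := exists_extension hF (good_spaceR hS) (cart (retrR E F) Q) κR hκR'
    (contractR E F) (by rw [hκR]; exact cylι_zero_contractR E F) (cylι_one_contractR E F)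
    (by rw [hκR]; exact cylMap_inclR_contractR E F) (rightHom T) (ιR E F) (by rw [hκR]; rfl)
  refine ⟨ψL, ψR, hψL, hψR, hψL', hψR', ?_⟩
  rw [← hψL'] at h0
  rw [← hψR'] at h1
  rw [← comparison_left hS Θ hΘ hk hk' hκL hκL' hα hα' hψL h0,
    ← comparison_right hS Θ hΘ hk hk' hκR hκR' hβ hβ' hψR h1]

lemma map_comp_hom_eq_iff {A Y : GSpace G} {f : A ⟶ Y} {S S' : M.Tw Y} {N : M.Tw A}
    (l : (M.pull f).obj S ≅ N) (l' : (M.pull f).obj S' ≅ N) (θ : S ⟶ S') :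
    (M.pull f).map θ ≫ l'.hom = l.hom ↔
      (⟨f, l.inv⟩ : mk A N ⟶ mk Y S) ≫ vert θ = (⟨f, l'.inv⟩ : mk A N ⟶ mk Y S') := by
  rw [mk_comp_vert, ← Iso.eq_comp_inv, ← Iso.inv_comp_eq]
  exact ⟨fun h => congrArg (Hom.mk (A := mk A N) (B := mk Y S') f) h, fun h => by injection h⟩

lemma sphereTwist_equiv_iff (T T' : SphereTwist M P Q) :
    T ≈ T' ↔ ∃ θ : T.tw ≅ T'.tw,
      leftHom T ≫ vert θ.hom = leftHom T' ∧ rightHom T ≫ vert θ.hom = rightHom T' :=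
  exists_congr fun θ =>
    and_congr (map_comp_hom_eq_iff _ _ θ.hom) (map_comp_hom_eq_iff _ _ θ.hom)

/-- Twists on the sphere bundle that induce the same isomorphism are isomorphic. -/
lemma equiv_of_induces [IsTopologicalGroup G] (hE : M.Good E.tot) (hF : M.Good F.tot)
    (hS : M.Good (sphere E F)) {T T' : SphereTwist M P Q}
    {u : (M.pull (fst E F)).obj P ≅ (M.pull (snd E F)).obj Q} (h : Induces T u)
    (h' : Induces T' u) : T ≈ T' := by
  obtain ⟨κL, hκL, hκL'⟩ := exists_inclL_lift (F := F) P
  obtain ⟨κR, hκR, hκR'⟩ := exists_inclR_lift (E := E) Q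
  obtain ⟨α, hα, hα'⟩ := exists_jL_lift (F := F) P
  obtain ⟨β, hβ, hβ'⟩ := exists_jR_lift u
  obtain ⟨ψL, ψR, h1, h2, h3, h4, h5⟩ :=
    exists_charts hE hF hS h hκL hκL' hκR hκR' hα hα' hβ hβ'
  obtain ⟨ψL', ψR', h1', h2', h3', h4', h5'⟩ :=
    exists_charts hE hF hS h' hκL hκL' hκR hκR' hα hα' hβ hβ'
  obtain ⟨θ, hθ, hθ'⟩ := exists_iso_of_glue_sphere hS α β hα hβ h1 h2 h1' h2' h5 h5'
  refine (sphereTwist_equiv_iff T T').2 ⟨θ, ?_, ?_⟩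
  · rw [← h3, Category.assoc, hθ, h3']
  · rw [← h4, Category.assoc, hθ', h4']

/-- Compose the lifted homotopy with the isomorphism of twists. -/
lemma Induces.of_equiv {T T' : SphereTwist M P Q}
    {u : (M.pull (fst E F)).obj P ≅ (M.pull (snd E F)).obj Q} (h : Induces T u) (e : T ≈ T') :
    Induces T' u := by
  obtain ⟨θ, hl, hr⟩ := (sphereTwist_equiv_iff T T').1 e
  obtain ⟨Θ, hΘ, h0, h1⟩ := (induces_iff T u).1 h
  refine (induces_iff T' u).2 ⟨Θ ≫ vert θ.hom, ?_, ?_, ?_⟩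
  · rw [comp_base, hΘ]
    rfl
  · rw [← hl, ← Category.assoc, h0, Category.assoc]
  · rw [← hr, ← Category.assoc, h1, Category.assoc]

lemma cylIncl_comp_vert {Z : GSpace G} {R R' : M.Tw Z} (φ : R ⟶ R') (s : unitInterval) :
    cylIncl R s ≫ vert ((M.pull Z.cylProj).map φ) = vert φ ≫ cylIncl R' s := by
  refine hom_ext (a := cylIncl R s ≫ vert _) (a' := vert φ ≫ cylIncl R' s)
    (cart Z.cylProj R') rfl ?_
  rw [Category.assoc, vert_map_comp_cart, ← Category.assoc, cylIncl_comp_cart, Category.id_comp,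
    Category.assoc, cylIncl_comp_cart, Category.comp_id]

/-- Precompose the lifted homotopy with the constant homotopy at `p^*a`. The inverse on `a` arises
because `leftHom` uses the inverse of `resl`. -/
lemma Induces.conj {T : SphereTwist M P Q}
    {u : (M.pull (fst E F)).obj P ≅ (M.pull (snd E F)).obj Q} (h : Induces T u)
    (a : P ≅ P) (b : Q ≅ Q) : Induces ⟨T.tw, T.resl ≪≫ a.symm, T.resr ≪≫ b⟩
      ((M.pull (fst E F)).mapIso a ≪≫ u ≪≫ (M.pull (snd E F)).mapIso b) := by
  obtain ⟨Θ, hΘ, h0, h1⟩ := (induces_iff T u).1 h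
  have hl : leftHom ⟨T.tw, T.resl ≪≫ a.symm, T.resr ≪≫ b⟩ = vert a.hom ≫ leftHom T :=
    (vert_comp_mk _ _ _).symm
  have hr : rightHom ⟨T.tw, T.resl ≪≫ a.symm, T.resr ≪≫ b⟩ = vert b.inv ≫ rightHom T :=
    (vert_comp_mk _ _ _).symm
  have hu : toRight ((M.pull (fst E F)).mapIso a ≪≫ u ≪≫ (M.pull (snd E F)).mapIso b) =
      vert ((M.pull (fst E F)).map a.hom) ≫ toRight u ≫ vert b.hom := by
    rw [toRight, toRight, mk_comp_vert, vert_comp_mk]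
    rfl
  refine (induces_iff _ _).2
    ⟨vert ((M.pull (fiberProd E F).cylProj).map ((M.pull (fst E F)).map a.hom)) ≫ Θ, ?_, ?_, ?_⟩
  · rw [comp_base, hΘ]
    rfl
  · rw [← Category.assoc, cylIncl_comp_vert, Category.assoc, h0, ← Category.assoc,
      vert_map_comp_cart, Category.assoc, hl]
  · rw [← Category.assoc, cylIncl_comp_vert, Category.assoc, h1, hu, hr]
    simp only [Category.assoc]
    rw [← Category.assoc (vert b.hom), vert_hom_inv, Category.id_comp]

lemma nonempty_iso_iff [IsTopologicalGroup G] (hE : M.Good E.tot) (hF : M.Good F.tot)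
    (hEF : M.Good (fiberProd E F)) (hS : M.Good (sphere E F)) {T T' : SphereTwist M P Q}
    {u u' : (M.pull (fst E F)).obj P ≅ (M.pull (snd E F)).obj Q} (h : Induces T u)
    (h' : Induces T' u') : Nonempty (T.tw ≅ T'.tw) ↔ ∃ (a : P ≅ P) (b : Q ≅ Q),
      u' = (M.pull (fst E F)).mapIso a ≪≫ u ≪≫ (M.pull (snd E F)).mapIso b := by
  constructor
  · rintro ⟨θ⟩
    -- `a` and `b` measure how far `θ` is from respecting the identifications; absorbing them into
    -- those of `T` makes `θ` compatible.
    let a : P ≅ P := T'.resl.symm ≪≫ (M.pull (inl E F)).mapIso θ.symm ≪≫ T.resl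
    let b : Q ≅ Q := T.resr.symm ≪≫ (M.pull (inr E F)).mapIso θ ≪≫ T'.resr
    refine ⟨a, b, induces_unique hEF h' ((h.conj a b).of_equiv ⟨θ, ?_, ?_⟩)⟩
    · simp [a]
    · simp [b]
  · rintro ⟨a, b, rfl⟩
    obtain ⟨θ, -⟩ := equiv_of_induces hE hF hS (h.conj a b) h'
    exact ⟨θ⟩

end Main

end TDuality

end

theorem mainTheorem9 {G : Type u} [Group G] [TopologicalSpace G] [IsTopologicalGroup G]
    (M : TwistModel.{u, v, w} G) {X : GSpace G} (E F : CircleBundle X)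
    (hE : M.Good E.tot) (hF : M.Good F.tot) (hEF : M.Good (fiberProd E F))
    (hS : M.Good (sphere E F)) (P : M.Tw E.tot) (Q : M.Tw F.tot) :
    ∃ Φ : ((M.pull (fst E F)).obj P ≅ (M.pull (snd E F)).obj Q) ≃
        Quotient (sphereTwistSetoid P Q),
      (∀ u T, Φ u = ⟦T⟧ ↔ Induces T u) ∧
      (∀ T T' : SphereTwist M P Q, Nonempty (T.tw ≅ T'.tw) ↔
        ∃ (a : P ≅ P) (b : Q ≅ Q), Φ.symm ⟦T'⟧ =
          (M.pull (fst E F)).mapIso a ≪≫ Φ.symm ⟦T⟧ ≪≫ (M.pull (snd E F)).mapIso b) := by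
  -- The bijection sends `u` to the class of any twist inducing it.
  choose τ hτ using exists_sphereTwist_induces (P := P) (Q := Q) hEF hS
  have hiff (u) (T : SphereTwist M P Q) :
      (⟦τ u⟧ : Quotient (sphereTwistSetoid P Q)) = ⟦T⟧ ↔ Induces T u :=
    ⟨fun h => (hτ u).of_equiv (Quotient.exact h),
      fun h => Quotient.sound (equiv_of_induces hE hF hS (hτ u) h)⟩
  let Φ : ((M.pull (fst E F)).obj P ≅ (M.pull (snd E F)).obj Q) ≃
      Quotient (sphereTwistSetoid P Q) := Equiv.ofBijective (fun u => ⟦τ u⟧)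
    -- If the classes agree, the single twist `τ u'` induces both `u` and `u'`.
    ⟨fun u u' h => induces_unique hEF ((hiff u _).1 h) (hτ u'), fun q => by
      induction q using Quotient.inductionOn with
      | h T =>
        obtain ⟨u, hu⟩ := exists_induces hEF T
        exact ⟨u, (hiff u T).2 hu⟩⟩
  have hΦ (T : SphereTwist M P Q) : Induces T (Φ.symm ⟦T⟧) :=
    (hiff _ T).1 (Φ.apply_symm_apply ⟦T⟧)
  exact ⟨Φ, hiff, fun T T' => nonempty_iso_iff hE hF hEF hS (hΦ T) (hΦ T')⟩
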